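/- A quandle is a set $X$ with a binary operation $\triangleleft$ such that $(a\triangleleft b)\triangleleft c=(a\triangleleft c)\triangleleft(b\triangleleft c)$ and $a\triangleleft a=a$ for all $a,b,c\in X$, and such that all right translations $-\triangleleft b$ are bijections of $X$; it is abelian if $(a\triangleleft b)\triangleleft c=(a\triangleleft c)\triangleleft b$ always holds. Its orbits are those of the group generated by the right translations. Its structure group is $G(X)=\langle g_a,\ a\in X \mid g_ag_b=g_bg_{a\triangleleft b},\ a,b\in X\rangle$. Its second (rack) homology group is $H_2(X)=\ker d_2/\operatorname{im} d_3$, where $d_2:\mathbb{Z}X^2\to\mathbb{Z}X$, $d_2(a,b)=a\triangleleft b-a$, and $d_3:\mathbb{Z}X^3\to\mathbb{Z}X^2$, $d_3(a,b,c)=(a\triangleleft b,c)-(a,c)-(a\triangleleft c,b\triangleleft c)+(a,b)$; put $Q_2(X)=\mathbb{Z}X^2/\operatorname{im} d_3\supseteq H_2(X)$. *Parameters.* Let $r\ge 2$, and let $M=(m_{i,j})_{1\le j\le i<r}$ be integers with $m_{i,i}\ge 1$ for all $i$ and $0\le m_{j,i}<m_{i,i}$ for $i<j$. Let $G(M)$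 be the abelian group with generators $x_1,\dots,x_{r-1}$ and relations $x_1^{m_{i,1}}\cdots x_i^{m_{i,i}}=1$ $(1\le i<r)$, and put $x_0=1$. For $r$ such collections $M^{(1)},\dots,M^{(r)}$, let $Q(M^{(1)},\dots,M^{(r)})$ be the disjoint union of the $G(M^{(i)})$ with $a\triangleleft b=a\,x^{(i)}_{k}$ for $a\in G(M^{(i)})$, $b\in G(M^{(i+k)})$, $0\le k<r$, upper indices modulo $r$; here $x^{(i)}_k$ denotes the element $x_k$ of $G(M^{(i)})$. Every finite abelian quandle $X$ with $r\ge 2$ ordered orbits is isomorphic, respecting the order of the orbits, to $Q(M^{(1)},\dots,M^{(r)})$ for exactly one choice of $M^{(1)},\dots,M^{(r)}$, called the parameters of $X$. The parameter group of $X$ is $G'(X)=\prod_{i=1}^r G(M^{(i)})\big/\langle x^{(i)}_{j-i}x^{(j)}_{i-j},\ 1\le i<j\le r\rangle$, lower indices modulo $r$. *Torsion groups.* For $a\in X$, the path map $p_a:G(X)\to Q_2(X)$ sends an element written as a word $g_{b_1}^{\epsilon_1}\cdots g_{b_k}^{\epsilon_k}$, $\epsilon_l=\pm1$, to the signed sum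 of the edges of the path that starts at $a$ and whose $l$-th step goes along the edge $(a',b_l)$ from $a'$ to $a'\triangleleft b_l$ if $\epsilon_l=1$ (counted as $+(a',b_l)$), and backwards along the edge $(a',b_l)$ from $a'\triangleleft b_l$ to $a'$ if $\epsilon_l=-1$ (counted as $-(a',b_l)$). For a finite abelian quandle $X$ with orbits $O_1,\dots,O_r$, the torsion group $T_i$ is the image under $p_a$ of the commutator subgroup of $G(X)$, for any $a\in O_i$; it is a subgroup of $H_2(X)$. *The quandle.* For integers $m,n\ge 1$, let $U^{\star}_{m,n}=\{x_i : i\in\mathbb{Z}/m\}\sqcup\{y_k : k\in\mathbb{Z}/n\}\sqcup\{z_s : s\in\mathbb{Z}/2\}$ with $$x_i\triangleleft y_k=x_{i+1},\quad y_k\triangleleft x_i=y_{k+1},\quad z_s\triangleleft x_i=z_s\triangleleft y_k=z_{s+1},$$ and $a\triangleleft b=a$ for all other pairs $(a,b)$. This is a finite abelian quandle with three orbits, $O_1=\{x_i\}$, $O_2=\{y_k\}$, $O_3=\{z_0,z_1\}$, in this order. **Proposition.** For all integers $m,n\ge 1$, with $\mathbb{Z}_k=\mathbb{Z}/k\mathbb{Z}$: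 1. The parameter group of $U^{\star}_{m,n}$ is $G'(U^{\star}_{m,n})\cong\mathbb{Z}_{\gcd(m,n)}$. 2. $H_2(U^{\star}_{m,n})\cong\mathbb{Z}^9\oplus(\mathbb{Z}_{\gcd(m,n)})^2\oplus\mathbb{Z}_{\gcd(m,n,2)}$. 3. The torsion groups of $U^{\star}_{m,n}$ are $T_1\cong T_2\cong G'(U^{\star}_{m,n})$ and $T_3\cong\mathbb{Z}_{\gcd(m,n,2)}$. In particular, $T_3\cong G'(U^{\star}_{m,n})$ if and only if $\gcd(m,n)\in\{1,2\}$. -/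

import Mathlib

namespace AbQuandle

/-- The right-handed quandle operation `a ◁ b`: the element `b` acts on `a` by its right translation.
In Mathlib's class `Quandle` the acting element is written first. -/
notation:65 a:65 " ◁ " b:66 => Shelf.act b a

section StructureGroup

variable (X : Type*) [Rack X]

/-- The relators of the structure group: `g_a g_b = g_b g_{a ◁ b}` for all `a b : X`. -/
def structureRels : Set (FreeGroup X) :=
  {w | ∃ a b : X, w = FreeGroup.of a * FreeGroup.of b *
    (FreeGroup.of b * FreeGroup.of (a ◁ b))⁻¹}

/-- The structure group `G(X) = ⟨ g_a, a ∈ X ∣ g_a g_b = g_b g_{a ◁ b} ⟩`. -/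
abbrev StructureGroup : Type _ := PresentedGroup (structureRels X)

end StructureGroup

section Homology

variable (X : Type*) [Rack X]

/-- The differential `d₂ : ℤX² → ℤX` of the rack complex, `d₂(a, b) = a ◁ b - a`. -/
noncomputable def d₂ : (X × X →₀ ℤ) →ₗ[ℤ] (X →₀ ℤ) :=
  Finsupp.linearCombination ℤ fun p =>
    Finsupp.single (p.1 ◁ p.2) 1 - Finsupp.single p.1 1

/-- The differential `d₃ : ℤX³ → ℤX²` of the rack complex,
`d₃(a, b, c) = (a ◁ b, c) - (a, c) - (a ◁ c, b ◁ c) + (a, b)`. -/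
noncomputable def d₃ : (X × X × X →₀ ℤ) →ₗ[ℤ] (X × X →₀ ℤ) :=
  Finsupp.linearCombination ℤ fun p =>
    Finsupp.single (p.1 ◁ p.2.1, p.2.2) 1 - Finsupp.single (p.1, p.2.2) 1
      - Finsupp.single (p.1 ◁ p.2.2, p.2.1 ◁ p.2.2) 1 + Finsupp.single (p.1, p.2.1) 1

/-- Boundaries are cycles. -/
theorem range_d₃_le_ker_d₂ : LinearMap.range (d₃ X) ≤ LinearMap.ker (d₂ X) := by
  rw [LinearMap.range_le_ker_iff]
  ext ⟨a, b, c⟩ : 2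
  have h : (a ◁ b) ◁ c = (a ◁ c) ◁ (b ◁ c) := Shelf.self_distrib
  ext1
  simp [d₂, d₃, h]
  abel

/-- The second (rack) homology group `H₂(X) = ker d₂ / im d₃`. -/
abbrev H₂ : Type _ :=
  ↥(LinearMap.ker (d₂ X)) ⧸ (LinearMap.range (d₃ X)).submoduleOf (LinearMap.ker (d₂ X))

/-- The quotient `Q₂(X) = ℤX² / im d₃`, which contains `H₂(X)`. -/
abbrev Q₂ : Type _ := (X × X →₀ ℤ) ⧸ LinearMap.range (d₃ X)

variable {X}

/-- The class in `Q₂(X)` of the edge `(a, b)`, which goes from `a` to `a ◁ b`. -/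
noncomputable def edge (a b : X) : Q₂ X :=
  Submodule.Quotient.mk (Finsupp.single (a, b) 1)

theorem edge_square (a b c : X) :
    edge a b + edge (a ◁ b) c = edge a c + edge (a ◁ c) (b ◁ c) := by
  have h : d₃ X (Finsupp.single (a, b, c) 1) ∈ LinearMap.range (d₃ X) := ⟨_, rfl⟩
  simp only [d₃, Finsupp.linearCombination_single, one_smul] at h
  unfold edge
  rw [← Submodule.Quotient.mk_add, ← Submodule.Quotient.mk_add, Submodule.Quotient.eq]
  simp only [d₃]
  convert h using 1
  generalize (Finsupp.single (a, b) 1 : X × X →₀ ℤ) = e₁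
  generalize (Finsupp.single (a ◁ b, c) 1 : X × X →₀ ℤ) = e₂
  generalize (Finsupp.single (a, c) 1 : X × X →₀ ℤ) = e₃
  generalize (Finsupp.single (a ◁ c, b ◁ c) 1 : X × X →₀ ℤ) = e₄
  abel

end Homology

section PathMaps

variable {X : Type*} [Rack X]

/-- One step of a path, recorded as (current vertex, sum of the edges travelled so far):
from the vertex `a` travel along the edge `(a, b)` to the vertex `a ◁ b`.  The inverse permutation
travels back along the edge `(a', b)` with `a' ◁ b = a`, which is counted negatively. -/
noncomputable def step (b : X) : Equiv.Perm (X × Q₂ X) where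
  toFun p := (p.1 ◁ b, p.2 + edge p.1 b)
  invFun p := (Rack.invAct b p.1, p.2 - edge (Rack.invAct b p.1) b)
  left_inv p := by simp
  right_inv p := by simp

/-- The right action of the structure group by travelling along paths: for a word in the
generators `g_b^{±1}`, the letters are read from left to right and each performs a `step`.
A right action is a homomorphism to the opposite of the permutation group. -/
noncomputable def travel : StructureGroup X →* (Equiv.Perm (X × Q₂ X))ᵐᵒᵖ :=
  PresentedGroup.toGroup (f := fun b => MulOpposite.op (step b)) (by
    rintro _ ⟨a, b, rfl⟩
    rw [map_mul, map_mul, map_inv, map_mul, mul_inv_eq_one]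
    simp only [FreeGroup.lift_apply_of]
    rw [← MulOpposite.op_mul, ← MulOpposite.op_mul]
    congr 1
    ext p : 1
    have h : (p.1 ◁ a) ◁ b = (p.1 ◁ b) ◁ (a ◁ b) := Shelf.self_distrib
    refine Prod.ext h ?_
    change p.2 + edge p.1 a + edge (p.1 ◁ a) b = p.2 + edge p.1 b + edge (p.1 ◁ b) (a ◁ b)
    rw [add_assoc, add_assoc, edge_square])

/-- The right action `a · g` of the structure group on `X`, with `a · g_b = a ◁ b`: the last
vertex of the path that starts at `a` and is described by `g`. -/
noncomputable def endpoint (a : X) (g : StructureGroup X) : X := ((travel g).unop (a, 0)).1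

/-- The path map `p_a : G(X) → Q₂(X)`: the signed sum of the edges of the path that starts at `a`
and is described by `g`. -/
noncomputable def pathMap (a : X) (g : StructureGroup X) : Q₂ X := ((travel g).unop (a, 0)).2

theorem travel_of (b : X) :
    travel (PresentedGroup.of b : StructureGroup X) = MulOpposite.op (step b) :=
  PresentedGroup.toGroup.of _

/-- The edges travelled do not depend on the sum accumulated before. -/
theorem travel_apply (g : StructureGroup X) (a : X) (q : Q₂ X) :
    (travel g).unop (a, q) = (endpoint a g, q + pathMap a g) := by
  suffices h : ∀ (p : X × Q₂ X) (q : Q₂ X), (travel g).unop (p.1, q + p.2) =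
      (((travel g).unop p).1, q + ((travel g).unop p).2) by
    simpa [endpoint, pathMap] using h (a, 0) q
  have hg : g ∈ Subgroup.closure (Set.range (PresentedGroup.of (rels := structureRels X))) := by
    rw [PresentedGroup.closure_range_of]; trivial
  induction hg using Subgroup.closure_induction with
  | mem g hg =>
    obtain ⟨b, rfl⟩ := hg
    intro p q
    simp [travel_of, step, add_assoc]
  | one => intro p q; simp
  | mul g g' _ _ ih ih' =>
    intro p q
    simp only [map_mul, MulOpposite.unop_mul, Equiv.Perm.mul_apply]
    rw [ih p q]
    exact ih' _ q
  | inv g _ ih =>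
    intro p q
    have h := ih ((travel g).unop.symm p) q
    rw [Equiv.apply_symm_apply] at h
    rw [map_inv, MulOpposite.unop_inv]
    exact (Equiv.symm_apply_eq _).2 h.symm

theorem endpoint_of (a b : X) : endpoint a (PresentedGroup.of b) = a ◁ b := by
  simp [endpoint, travel_of, step]

theorem pathMap_of (a b : X) : pathMap a (PresentedGroup.of b) = edge a b := by
  simp [pathMap, travel_of, step]

theorem endpoint_one (a : X) : endpoint a 1 = a := by simp [endpoint]

theorem pathMap_one (a : X) : pathMap a 1 = 0 := by simp [pathMap]

theorem endpoint_mul (a : X) (g g' : StructureGroup X) :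
    endpoint a (g * g') = endpoint (endpoint a g) g' := by
  have h : (travel (g * g')).unop (a, 0) = (travel g').unop ((travel g).unop (a, 0)) := by
    simp
  rw [travel_apply, travel_apply g, travel_apply g'] at h
  exact (Prod.mk.inj h).1

theorem pathMap_mul (a : X) (g g' : StructureGroup X) :
    pathMap a (g * g') = pathMap a g + pathMap (endpoint a g) g' := by
  have h : (travel (g * g')).unop (a, 0) = (travel g').unop ((travel g).unop (a, 0)) := by
    simp
  rw [travel_apply, travel_apply g, travel_apply g'] at h
  simpa using congrArg Prod.snd h

/-- The torsion group at `a`: the image under the path map `p_a` of the commutator subgroup of the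
structure group (of its part that stabilises `a`, which is all of it when the quandle is abelian).
For a finite abelian quandle and `a` in the `i`-th orbit this is the torsion group `T_i`. -/
def torsionGroup (a : X) : AddSubgroup (Q₂ X) where
  carrier := {q | ∃ g ∈ commutator (StructureGroup X), endpoint a g = a ∧ pathMap a g = q}
  zero_mem' := ⟨1, one_mem _, endpoint_one a, pathMap_one a⟩
  add_mem' := by
    rintro _ _ ⟨g, hg, h, rfl⟩ ⟨g', hg', h', rfl⟩
    refine ⟨g * g', mul_mem hg hg', ?_, ?_⟩
    · rw [endpoint_mul, h, h']
    · rw [pathMap_mul, h]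
  neg_mem' := by
    rintro _ ⟨g, hg, h, rfl⟩
    have h1 : endpoint a g⁻¹ = a := by
      have := endpoint_mul a g g⁻¹
      rw [mul_inv_cancel, endpoint_one, h] at this
      exact this.symm
    refine ⟨g⁻¹, inv_mem hg, h1, ?_⟩
    have := pathMap_mul a g g⁻¹
    rw [mul_inv_cancel, pathMap_one, h] at this
    exact (neg_eq_of_add_eq_zero_right this.symm).symm

end PathMaps

section Parameters

variable {s : ℕ}

/-- A collection of parameters `(m_{i,j})_{1 ≤ j ≤ i ≤ s}`, as a lower triangular matrix with
`1 ≤ m_{i,i}` and `0 ≤ m_{j,i} < m_{i,i}` for `i < j`. -/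
def IsParamMatrix (M : Matrix (Fin s) (Fin s) ℕ) : Prop :=
  (∀ i, 1 ≤ M i i) ∧ (∀ i j, i < j → M j i < M i i) ∧ (∀ i j, i < j → M i j = 0)

/-- The abelian group `G(M)` with generators `x_1, …, x_s` and relations
`x_1^{m_{i,1}} ⋯ x_i^{m_{i,i}} = 1` for `1 ≤ i ≤ s`, written additively. -/
abbrev ParamOrbit (M : Matrix (Fin s) (Fin s) ℕ) : Type :=
  (Fin s → ℤ) ⧸ AddSubgroup.closure (Set.range fun i : Fin s => fun j : Fin s => (M i j : ℤ))

/-- The elements `x_0, x_1, …, x_s` of `G(M)`: `x_0` is the neutral element and `x_1, …, x_s` are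
the generators. -/
def paramGen (M : Matrix (Fin s) (Fin s) ℕ) : Fin (s + 1) → ParamOrbit M :=
  Fin.cases 0 fun k => QuotientAddGroup.mk (Pi.single k 1)

/-- The underlying set `G(M⁽¹⁾) ⊔ ⋯ ⊔ G(M⁽ʳ⁾)`, `r = s + 1`, of the filtered-permutation quandle
with parameters `M`. -/
structure FPQuandle (M : Fin (s + 1) → Matrix (Fin s) (Fin s) ℕ) : Type where
  /-- The index of the component. -/
  index : Fin (s + 1)
  /-- The element of that component. -/
  elt : ParamOrbit (M index)

/-- The filtered-permutation quandle: `a ◁ b = a x_k` for `a` in the `i`-th and `b` in the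
`(i + k)`-th component, the index being taken modulo `r = s + 1`. -/
instance (M : Fin (s + 1) → Matrix (Fin s) (Fin s) ℕ) : Quandle (FPQuandle M) where
  act b a := ⟨a.index, a.elt + paramGen (M a.index) (b.index - a.index)⟩
  self_distrib := by
    rintro ⟨i, a⟩ ⟨j, b⟩ ⟨k, c⟩
    exact congrArg (FPQuandle.mk k) (add_right_comm _ _ _)
  invAct b a := ⟨a.index, a.elt - paramGen (M a.index) (b.index - a.index)⟩
  left_inv := by
    rintro ⟨i, a⟩ ⟨j, b⟩
    exact congrArg (FPQuandle.mk j) (add_sub_cancel_right _ _)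
  right_inv := by
    rintro ⟨i, a⟩ ⟨j, b⟩
    exact congrArg (FPQuandle.mk j) (sub_add_cancel _ _)
  fix := by
    rintro ⟨i, a⟩
    refine congrArg (FPQuandle.mk i) ?_
    simp [paramGen]

/-- `M⁽¹⁾, …, M⁽ʳ⁾` are the parameters of the quandle `X`, whose orbits are ordered by sending each
element to the index of its orbit: there is a quandle isomorphism from `X` to the
filtered-permutation quandle that respects the order of the orbits. -/
def HasParameters (X : Type*) [Quandle X] (orbitIndex : X → Fin (s + 1))
    (M : Fin (s + 1) → Matrix (Fin s) (Fin s) ℕ) : Prop :=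
  (∀ i, IsParamMatrix (M i)) ∧
    ∃ e : X ≃ FPQuandle M, (∀ a b, e (a ◁ b) = e a ◁ e b) ∧ ∀ a, (e a).index = orbitIndex a

/-- The parameter group: the quotient of `G(M⁽¹⁾) × ⋯ × G(M⁽ʳ⁾)` by the elements
`x⁽ⁱ⁾_{j-i} x⁽ʲ⁾_{i-j}` for `i < j`, lower indices modulo `r = s + 1`, written additively. -/
abbrev ParameterGroup (M : Fin (s + 1) → Matrix (Fin s) (Fin s) ℕ) : Type :=
  ((i : Fin (s + 1)) → ParamOrbit (M i)) ⧸ AddSubgroup.closure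
    {g | ∃ i j : Fin (s + 1), i < j ∧
      g = Pi.single i (paramGen (M i) (j - i)) + Pi.single j (paramGen (M j) (i - j))}

end Parameters

/-- The underlying set of the quandle `U⋆_{m,n}`: the elements `x_i` and `y_k` of `U_{m,n}`, with
`i` modulo `m` and `k` modulo `n`, and two more elements `z_0`, `z_1`. -/
inductive UStar (m n : ℕ) : Type
  | x (i : ZMod m) : UStar m n
  | y (k : ZMod n) : UStar m n
  | z (s : ZMod 2) : UStar m n

namespace UStar

variable {m n : ℕ}

/-- The operation `a ◁ b` of `U⋆_{m,n}`: elements `y_k` send `x_i` to `x_{i+1}`, elements `x_i` send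
`y_k` to `y_{k+1}`, both send `z_s` to `z_{s+1}`, and everything else is fixed. -/
def op : UStar m n → UStar m n → UStar m n
  | x i, y _ => x (i + 1)
  | y k, x _ => y (k + 1)
  | z s, x _ => z (s + 1)
  | z s, y _ => z (s + 1)
  | a, _ => a

/-- The inverse of the right translation by `b`. -/
def invOp : UStar m n → UStar m n → UStar m n
  | x i, y _ => x (i - 1)
  | y k, x _ => y (k - 1)
  | z s, x _ => z (s - 1)
  | z s, y _ => z (s - 1)
  | a, _ => a

instance : Quandle (UStar m n) where
  act b a := op a b
  self_distrib := by rintro (_ | _ | _) (_ | _ | _) (_ | _ | _) <;> rfl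
  invAct b a := invOp a b
  left_inv := by rintro (_ | _ | _) (_ | _ | _) <;> simp [op, invOp]
  right_inv := by rintro (_ | _ | _) (_ | _ | _) <;> simp [op, invOp]
  fix := by rintro (_ | _ | _) <;> rfl

/-- The order of the three orbits: first the `x_i`, then the `y_k`, then `z_0`, `z_1`. -/
def orbitIndex : UStar m n → Fin 3
  | x _ => 0
  | y _ => 1
  | z _ => 2

end UStar

end AbQuandle

/-! The vertices on the edges in one square relation all lie in one orbit as far as starting points
are concerned, so `Q₂` can be studied orbit by orbit. In `U⋆` the orbits are cycles. The square
relations force parallel edges whose labels lie in the same orbit to differ by multiples of a single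
element `θ 1`. Going once around each cycle of labels kills it after `m` and after `n` steps. On the
third orbit the relations also force `2 • θ 1 = 0`, because `x` and `y` both shift the two-element
cycle and shift each other (`exists_shift_hom`, `exists_shift_hom_two`). Conversely the explicit
function `edgeClass` satisfies all square relations, so `θ` is injective on the cyclic group of
order `gcd(m, n)`, respectively `gcd(m, n, 2)`.

Homology: each orbit contributes three free classes and the cyclic group generated by `θ 1`. For `x`
and `y` the free classes are two loops and the sum of the edges around the cycle; for `z` one loop
is replaced by the difference of a `y`-edge and an `x`-edge. Every edge is such a cycle plus a
difference of paths from a base point, which depends only on the boundary (`nonempty_H₂_equiv`).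

Torsion groups: `g_{b ◁ c} g_b⁻¹` is a commutator, so differences of parallel edges `(a, b ◁ c)` and
`(a, b)` lie in the torsion group. Modulo these differences the generators act commutatively on
paths, so nothing else occurs.

Parameter group: any parameters identify the three groups `G(M⁽ⁱ⁾)` with the integers modulo `m`,
`n` and `2`, the generators becoming the shifts. The relations are then `(1, 1, 0)` and `(0, 0, 1)`,
and `(a, b, c) ↦ a - b` has the quotient as its image. Finally `gcd(m, n, 2) = gcd(m, n)` exactly
when `gcd(m, n)` divides `2`. -/

namespace AbQuandle

/-! ### Homology and torsion groups of general racks. -/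

section Rack

open scoped commutatorElement

variable {X : Type*} [Rack X]

/-- The map out of `Q₂(X)` with prescribed values on the edges. -/
noncomputable def liftEdges {K : Type*} [AddCommGroup K] (f : X → X → K)
    (hf : ∀ a b c, f a b + f (a ◁ b) c = f a c + f (a ◁ c) (b ◁ c)) : Q₂ X →+ K :=
  ((LinearMap.range (d₃ X)).liftQ (Finsupp.linearCombination ℤ fun p : X × X => f p.1 p.2) (by
    rw [LinearMap.range_le_ker_iff]
    ext ⟨a, b, c⟩
    simp only [d₃, LinearMap.comp_apply, Finsupp.lsingle_apply, Finsupp.linearCombination_single,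
      one_smul, map_add, map_sub, LinearMap.zero_apply]
    have h := hf a b c
    rw [← sub_eq_zero] at h
    rw [← h]
    abel)).toAddMonoidHom

theorem liftEdges_edge {K : Type*} [AddCommGroup K] (f : X → X → K)
    (hf : ∀ a b c, f a b + f (a ◁ b) c = f a c + f (a ◁ c) (b ◁ c)) (a b : X) :
    liftEdges f hf (edge a b) = f a b := by
  change Finsupp.linearCombination ℤ (fun p : X × X => f p.1 p.2) (Finsupp.single (a, b) 1) = _
  simp

/-- The differential `d₂` on the quotient `Q₂(X)`. -/
noncomputable def boundary (X : Type*) [Rack X] : Q₂ X →+ (X →₀ ℤ) :=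
  ((LinearMap.range (d₃ X)).liftQ (d₂ X) (range_d₃_le_ker_d₂ X)).toAddMonoidHom

theorem boundary_mk (c : X × X →₀ ℤ) :
    boundary X ((LinearMap.range (d₃ X)).mkQ c) = d₂ X c := rfl

theorem boundary_edge (a b : X) :
    boundary X (edge a b) = Finsupp.single (a ◁ b) 1 - Finsupp.single a 1 :=
  (boundary_mk _).trans (by simp [d₂])

theorem Q₂_hom_ext {K : Type*} [AddCommGroup K] {f g : Q₂ X →+ K}
    (h : ∀ a b, f (edge a b) = g (edge a b)) : f = g := by
  have key : f.comp (LinearMap.range (d₃ X)).mkQ.toAddMonoidHom =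
      g.comp (LinearMap.range (d₃ X)).mkQ.toAddMonoidHom := by
    refine Finsupp.addHom_ext' fun p => AddMonoidHom.ext_int (h p.1 p.2)
  ext q
  obtain ⟨c, rfl⟩ := Submodule.mkQ_surjective _ q
  exact DFunLike.congr_fun key c

/-- To identify `H₂(X)` with `K` it is enough to split `Q₂(X)` as cycles coming from `K` plus a part
which is determined by its boundary. -/
theorem nonempty_H₂_equiv {K : Type*} [AddCommGroup K] (φ : Q₂ X →+ K) (σ : K →+ Q₂ X)
    (τ : (X →₀ ℤ) →+ Q₂ X) (hφσ : ∀ k, φ (σ k) = k) (hσ : ∀ k, boundary X (σ k) = 0)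
    (h : ∀ a b, edge a b = σ (φ (edge a b)) + τ (boundary X (edge a b))) :
    Nonempty (H₂ X ≃+ K) := by
  have key : ∀ q, q = σ (φ q) + τ (boundary X q) :=
    DFunLike.congr_fun (Q₂_hom_ext (f := AddMonoidHom.id _)
      (g := σ.comp φ + τ.comp (boundary X)) h)
  let φ' : Q₂ X →ₗ[ℤ] K :=
    { φ with map_smul' := fun c q => map_intCast_smul φ ℤ ℤ c q }
  let Φ : LinearMap.ker (d₂ X) →ₗ[ℤ] K :=
    φ' ∘ₗ (LinearMap.range (d₃ X)).mkQ ∘ₗ (LinearMap.ker (d₂ X)).subtype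
  -- For a cycle the term with `τ` in `key` vanishes, so a cycle killed by `φ` is zero in `Q₂(X)`,
  -- that is, a boundary.
  have hker : (LinearMap.range (d₃ X)).submoduleOf (LinearMap.ker (d₂ X)) = LinearMap.ker Φ := by
    ext ⟨c, hc⟩
    rw [Submodule.submoduleOf, Submodule.mem_comap, LinearMap.mem_ker]
    change c ∈ LinearMap.range (d₃ X) ↔ φ ((LinearMap.range (d₃ X)).mkQ c) = 0
    constructor
    · intro h
      have : (LinearMap.range (d₃ X)).mkQ c = 0 := (Submodule.Quotient.mk_eq_zero _).2 h
      rw [this, map_zero]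
    · intro h
      refine (Submodule.Quotient.mk_eq_zero _).1 ?_
      change (LinearMap.range (d₃ X)).mkQ c = 0
      rw [key ((LinearMap.range (d₃ X)).mkQ c), h, boundary_mk, LinearMap.mem_ker.1 hc, map_zero,
        map_zero, add_zero]
  have hsurj : Function.Surjective Φ := by
    intro k
    obtain ⟨c, hc⟩ := Submodule.mkQ_surjective _ (σ k)
    refine ⟨⟨c, ?_⟩, ?_⟩
    · rw [LinearMap.mem_ker, ← boundary_mk, hc, hσ]
    · change φ ((LinearMap.range (d₃ X)).mkQ c) = k
      rw [hc, hφσ]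
  exact ⟨((Submodule.quotEquivOfEq _ _ hker).trans
    (Φ.quotKerEquivOfSurjective hsurj)).toAddEquiv⟩

theorem endpoint_mem {S : Set X} (hS : ∀ a ∈ S, ∀ b, a ◁ b ∈ S)
    (hS' : ∀ a ∈ S, ∀ b, Rack.invAct b a ∈ S) (g : StructureGroup X) :
    ∀ a ∈ S, endpoint a g ∈ S := by
  -- Treating `g` and `g⁻¹` together makes the inverse step of the induction a mere swap.
  have key : ∀ g : StructureGroup X, (∀ a ∈ S, endpoint a g ∈ S) ∧ ∀ a ∈ S, endpoint a g⁻¹ ∈ S := by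
    intro g
    have hg : g ∈ Subgroup.closure (Set.range (PresentedGroup.of (rels := structureRels X))) := by
      rw [PresentedGroup.closure_range_of]; trivial
    induction hg using Subgroup.closure_induction with
    | mem g hg =>
      obtain ⟨b, rfl⟩ := hg
      refine ⟨fun a ha => ?_, fun a ha => ?_⟩
      · rw [endpoint_of]; exact hS a ha b
      · have h := endpoint_mul (Rack.invAct b a) (PresentedGroup.of b) (PresentedGroup.of b)⁻¹
        rw [mul_inv_cancel, endpoint_one, endpoint_of] at h
        rw [Rack.act_invAct_eq] at h
        rw [← h]
        exact hS' a ha b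
    | one => simp [endpoint_one]
    | mul g g' _ _ ih ih' =>
      refine ⟨fun a ha => ?_, fun a ha => ?_⟩
      · rw [endpoint_mul]; exact ih'.1 _ (ih.1 _ ha)
      · rw [mul_inv_rev, endpoint_mul]; exact ih.2 _ (ih'.2 _ ha)
    | inv g _ ih => exact ⟨ih.2, by rw [inv_inv]; exact ih.1⟩
  exact (key g).1

/-- Two elements of the structure group are congruent if, from every vertex in `S`, they describe
paths with the same last vertex and the same sum of edges modulo `T`. -/
def pathCon (S : Set X) (T : AddSubgroup (Q₂ X)) (hS : ∀ g, ∀ a ∈ S, endpoint a g ∈ S) :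
    Con (StructureGroup X) where
  r g h := ∀ a ∈ S, endpoint a g = endpoint a h ∧ pathMap a g - pathMap a h ∈ T
  iseqv :=
    { refl := fun g a _ => ⟨rfl, by simp⟩
      symm := fun h a ha => ⟨(h a ha).1.symm, by
        rw [← neg_sub]; exact neg_mem (h a ha).2⟩
      trans := fun h h' a ha => ⟨(h a ha).1.trans (h' a ha).1, by
        rw [← sub_add_sub_cancel]; exact add_mem (h a ha).2 (h' a ha).2⟩ }
  mul' := by
    intro g h g' h' H H' a ha
    -- Equality of the intermediate vertices lets the second halves of both paths start at the same
    -- point of `S`.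
    rw [endpoint_mul, endpoint_mul, pathMap_mul, pathMap_mul, ← (H a ha).1]
    refine ⟨(H' _ (hS g a ha)).1, ?_⟩
    rw [add_sub_add_comm]
    exact add_mem (H a ha).2 (H' _ (hS g a ha)).2

/-- The commutator subgroup acts trivially on an invariant set `S` on which right translations
commute, and its path maps have values in every subgroup which contains the differences of parallel
edges. -/
theorem pathMap_mem_of_mem_commutator {S : Set X} (T : AddSubgroup (Q₂ X))
    (hS : ∀ a ∈ S, ∀ b, a ◁ b ∈ S) (hS' : ∀ a ∈ S, ∀ b, Rack.invAct b a ∈ S)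
    (hcomm : ∀ a ∈ S, ∀ b c, (a ◁ b) ◁ c = (a ◁ c) ◁ b)
    (hT : ∀ a ∈ S, ∀ b c, edge a (b ◁ c) - edge a b ∈ T) {g : StructureGroup X}
    (hg : g ∈ commutator (StructureGroup X)) {a : X} (ha : a ∈ S) :
    endpoint a g = a ∧ pathMap a g ∈ T := by
  let C := pathCon S T (endpoint_mem hS hS')
  have hgen : ∀ b c : X, Commute (C.mk' (PresentedGroup.of b)) (C.mk' (PresentedGroup.of c)) := by
    intro b c
    refine (Con.eq C).2 fun a ha => ?_
    simp only [endpoint_mul, pathMap_mul, endpoint_of, pathMap_of]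
    refine ⟨hcomm a ha b c, ?_⟩
    -- By the square relation the two orders of travel differ only in the last edge at `a ◁ c`,
    -- labelled `b ◁ c` or `b`.
    rw [edge_square, add_sub_add_left_eq_sub]
    exact hT _ (hS a ha c) b c
  have htop (g : StructureGroup X) :
      g ∈ Subgroup.closure (Set.range (PresentedGroup.of (rels := structureRels X))) := by
    rw [PresentedGroup.closure_range_of]; trivial
  have hall : ∀ g h : StructureGroup X, Commute (C.mk' g) (C.mk' h) := by
    intro g h
    induction htop g using Subgroup.closure_induction with
    | mem g hg =>
      obtain ⟨b, rfl⟩ := hg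
      induction htop h using Subgroup.closure_induction with
      | mem h hh => obtain ⟨c, rfl⟩ := hh; exact hgen b c
      | one => rw [map_one]; exact Commute.one_right _
      | mul _ _ _ _ ih ih' => rw [map_mul]; exact ih.mul_right ih'
      | inv _ _ ih => exact ih.inv_right
    | one => rw [map_one]; exact Commute.one_left _
    | mul _ _ _ _ ih ih' => rw [map_mul]; exact ih.mul_left ih'
    | inv _ _ ih => exact ih.inv_left
  have hle : commutator (StructureGroup X) ≤ (C.mk' : StructureGroup X →* C.Quotient).ker := by
    rw [commutator_def, Subgroup.commutator_le]
    intro g _ h _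
    rw [MonoidHom.mem_ker, map_commutatorElement]
    exact commutatorElement_eq_one_iff_commute.2 (hall g h)
  have h1 : C.mk' g = C.mk' 1 := by rw [map_one]; exact hle hg
  have h2 := (Con.eq C).1 h1 a ha
  rw [endpoint_one, pathMap_one, sub_zero] at h2
  exact h2

/-- The difference of two parallel edges at `a` lies in the torsion group at `a`. -/
theorem edge_sub_edge_mem_torsionGroup {a b c : X} (h : a ◁ (b ◁ c) = a ◁ b) :
    edge a (b ◁ c) - edge a b ∈ torsionGroup a := by
  have hrel : (PresentedGroup.of b * PresentedGroup.of c : StructureGroup X) =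
      PresentedGroup.of c * PresentedGroup.of (b ◁ c) := by
    rw [← mul_inv_eq_one]
    exact PresentedGroup.one_of_mem ⟨b, c, rfl⟩
  -- The defining relation says that `g_{b ◁ c}` is the conjugate `g_c⁻¹ g_b g_c`.
  have hg : (PresentedGroup.of (b ◁ c) * (PresentedGroup.of b)⁻¹ : StructureGroup X) =
      ⁅(PresentedGroup.of c : StructureGroup X)⁻¹, (PresentedGroup.of b : StructureGroup X)⁆ := by
    rw [commutatorElement_def, inv_inv, mul_assoc _ (PresentedGroup.of b) (PresentedGroup.of c),
      hrel]
    group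
  have hpath := pathMap_mul a (PresentedGroup.of (b ◁ c) * (PresentedGroup.of b)⁻¹)
    (PresentedGroup.of b)
  have hend : endpoint a (PresentedGroup.of (b ◁ c) * (PresentedGroup.of b)⁻¹) = a := by
    have h1 := endpoint_mul a (PresentedGroup.of b) (PresentedGroup.of b)⁻¹
    rw [mul_inv_cancel, endpoint_one, endpoint_of, ← h] at h1
    rw [endpoint_mul, endpoint_of, ← h1]
  refine ⟨_, ?_, hend, ?_⟩
  · rw [hg, commutator_def]
    exact Subgroup.commutator_mem_commutator (Subgroup.mem_top _) (Subgroup.mem_top _)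
  -- The path of `g_{b ◁ c} g_b⁻¹` is closed at `a`; following it by the edge `(a, b)` gives the
  -- single edge `(a, b ◁ c)`.
  · rw [inv_mul_cancel_right, hend, pathMap_of, pathMap_of] at hpath
    exact eq_sub_of_add_eq hpath.symm

/-- If parallel edges at the vertices of an invariant set `S` differ by elements in the image of
`θ`, if the image of `1` is such a difference at `a ∈ S`, and if `θ` is injective, then the torsion
group at `a` is cyclic. -/
theorem nonempty_torsionGroup_equiv {S : Set X} {d : ℕ} (θ : ZMod d →+ Q₂ X)
    (hS : ∀ a ∈ S, ∀ b, a ◁ b ∈ S) (hS' : ∀ a ∈ S, ∀ b, Rack.invAct b a ∈ S)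
    (hcomm : ∀ a ∈ S, ∀ b c, (a ◁ b) ◁ c = (a ◁ c) ◁ b)
    (hθ : ∀ a ∈ S, ∀ b c, edge a (b ◁ c) - edge a b ∈ θ.range) (hinj : Function.Injective θ)
    {a : X} (ha : a ∈ S) (h1 : θ 1 ∈ torsionGroup a) :
    Nonempty (torsionGroup a ≃+ ZMod d) := by
  have heq : torsionGroup a = θ.range := by
    apply le_antisymm
    · rintro _ ⟨g, hg, -, rfl⟩
      exact (pathMap_mem_of_mem_commutator _ hS hS' hcomm hθ hg ha).2
    · rintro _ ⟨k, rfl⟩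
      obtain ⟨k, rfl⟩ := ZMod.intCast_surjective k
      rw [← zsmul_one, map_zsmul]
      exact zsmul_mem h1 k
  rw [heq]
  exact ⟨(AddMonoidHom.ofInjective hinj).symm⟩

end Rack

/-! ### Square relations as functional equations on cyclic groups. -/

section ZMod

variable {A : Type*} [AddCommGroup A]

theorem eq_add_of_forall_add_one {p : ℕ} [NeZero p] (u : ZMod p → A) (v : ZMod p →+ A)
    (h : ∀ t, u (t + 1) = u t + v 1) (t : ZMod p) : u t = u 0 + v t := by
  rw [← ZMod.natCast_zmod_val t]
  induction t.val with
  | zero => simp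
  | succ k ih => rw [Nat.cast_succ, h, ih, map_add, add_assoc]

theorem nsmul_eq_zero_of_forall_add_one {p : ℕ} (u : ZMod p → A) (θ : A)
    (h : ∀ t, u (t + 1) = u t + θ) : p • θ = 0 := by
  have key : ∀ k : ℕ, u k = u 0 + k • θ := by
    intro k
    induction k with
    | zero => simp
    | succ k ih => rw [Nat.cast_succ, h, ih, succ_nsmul, add_assoc]
  simpa using key p

theorem exists_hom_of_nsmul {d : ℕ} (θ : A) (h : d • θ = 0) : ∃ f : ZMod d →+ A, f 1 = θ := by
  refine ⟨ZMod.lift d ⟨(zmultiplesHom A) θ, by simpa using h⟩, ?_⟩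
  have := ZMod.lift_coe d (⟨(zmultiplesHom A) θ, by simpa using h⟩ : {f : ℤ →+ A // f d = 0}) 1
  simpa using this

theorem gcd_nsmul_eq_zero {p q : ℕ} {θ : A} (hp : p • θ = 0) (hq : q • θ = 0) :
    Nat.gcd p q • θ = 0 := by
  rw [← addOrderOf_dvd_iff_nsmul_eq_zero] at *
  exact Nat.dvd_gcd hp hq

/-- The sums of `h` along the arc from `0` to `i`. -/
def arcSum {p : ℕ} (h : ZMod p → A) (i : ZMod p) : A := ∑ j ∈ Finset.range i.val, h j

/-- The indicator of the last step of the cycle `0, 1, …, p - 1, 0`. -/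
def lastStep {p : ℕ} (i : ZMod p) : ℤ := if i + 1 = 0 then 1 else 0

/-- The arc sums telescope except where the cycle closes: at the last vertex `arcSum` drops back to
`0`, and the defect is the full sum around the cycle. This separates an edge into a cycle and a part
determined by its boundary. -/
theorem arcSum_add_one {p : ℕ} [NeZero p] (h : ZMod p → A) (i : ZMod p) :
    h i = lastStep i • (∑ j ∈ Finset.range p, h j) + (arcSum h (i + 1) - arcSum h i) := by
  have hi : (((i.val + 1 : ℕ)) : ZMod p) = i + 1 := by simp
  have hs : (∑ j ∈ Finset.range (i.val + 1), h j) = arcSum h i + h i := by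
    rw [Finset.sum_range_succ, ZMod.natCast_zmod_val, arcSum]
  unfold lastStep
  rcases (Nat.succ_le_of_lt (ZMod.val_lt i)).lt_or_eq with hlt | heq
  · have hv : (i + 1).val = i.val + 1 := by rw [← hi, ZMod.val_natCast_of_lt hlt]
    have h0 : i + 1 ≠ 0 := by
      intro h0
      rw [h0, ZMod.val_zero] at hv
      omega
    rw [if_neg h0, zero_smul, zero_add, arcSum, hv, hs, add_sub_cancel_left]
  · have h0 : i + 1 = 0 := by
      rw [← hi, ← Nat.succ_eq_add_one, heq, ZMod.natCast_self]
    have hz : arcSum h (0 : ZMod p) = 0 := by simp [arcSum]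
    have hp : (∑ j ∈ Finset.range p, h j) = arcSum h i + h i := by
      rw [← hs]
      exact congrArg (fun k => ∑ j ∈ Finset.range k, h (j : ℕ)) heq.symm
    rw [if_pos h0, one_smul, h0, hz, hp]
    abel

theorem sum_lastStep {p : ℕ} [NeZero p] :
    ∑ j ∈ Finset.range p, lastStep (j : ZMod p) = 1 := by
  obtain ⟨k, rfl⟩ := Nat.exists_eq_succ_of_ne_zero (NeZero.ne p)
  rw [Finset.sum_eq_single k]
  · have : ((k : ZMod k.succ)) + 1 = 0 := by exact_mod_cast ZMod.natCast_self (k + 1)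
    simp [lastStep, this]
  · intro j hj hjk
    rw [lastStep, if_neg]
    intro h
    have h' : ((j + 1 : ℕ) : ZMod (k + 1)) = 0 := by exact_mod_cast h
    rw [ZMod.natCast_eq_zero_iff] at h'
    have := Nat.le_of_dvd (by omega) h'
    rw [Finset.mem_range] at hj
    omega
  · intro h; simp at h

theorem sum_shift_sub {p : ℕ} (h : ZMod p → A) :
    ∑ j ∈ Finset.range p, (h (j + 1) - h j) = 0 := by
  have := Finset.sum_range_sub (fun j : ℕ => h j) p
  simpa using this

/-- The edges that start in a cycle of length `p` in which the shifts are labelled by a cycle of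
length `q`: solution of the square relations. -/
theorem exists_shift_hom {p q : ℕ} [NeZero p] [NeZero q] (F : ZMod p → ZMod p → A)
    (H : ZMod p → ZMod q → A) (hF : ∀ a j, F (a + 1) (j + 1) = F a j)
    (hH : ∀ a k j, H a k + F (a + 1) j = F a j + H a (k + 1)) {d : ℕ} (hd : d = Nat.gcd p q)
    (hdp : d ∣ p) (hdq : d ∣ q) :
    ∃ θ : ZMod d →+ A, (∀ a j, F a j = F 0 0 + θ (ZMod.castHom hdp (ZMod d) (a - j))) ∧
      ∀ a k, H a k = H a 0 + θ (ZMod.castHom hdq (ZMod d) k) := by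
  have hF' : ∀ (j : ℕ) a, F (a + j) j = F a 0 := by
    intro j
    induction j with
    | zero => intro a; simp
    | succ j ih => intro a; rw [Nat.cast_succ, ← add_assoc, hF, ih]
  have hF0 : ∀ a j, F a j = F (a - j) 0 := by
    intro a j
    have := hF' j.val (a - j)
    rwa [ZMod.natCast_zmod_val, sub_add_cancel] at this
  -- The left side does not involve `j` and the right side does not involve `k`, so both depend on
  -- `a` alone.
  have hH' : ∀ a k j, H a (k + 1) - H a k = F (a + 1) j - F a j := by
    intro a k j
    rw [sub_eq_sub_iff_add_eq_add, add_comm, ← hH, add_comm]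
  -- Replacing `j = 0` by `j = a` turns the difference at `a` into the one at `0`, since `F` depends
  -- only on `a - j`. The increment is therefore constant.
  have hd1 : ∀ a, F (a + 1) 0 - F a 0 = F 1 0 - F 0 0 := by
    intro a
    rw [← hH' a 0 0, hH' a 0 a, hF0 (a + 1), hF0 a a, add_sub_cancel_left, sub_self]
  have hFs : ∀ a, F (a + 1) 0 = F a 0 + (F 1 0 - F 0 0) := fun a => by
    rw [← hd1 a, add_sub_cancel]
  have hHs : ∀ a k, H a (k + 1) = H a k + (F 1 0 - F 0 0) := fun a k => by
    rw [← hd1 a, ← hH' a k, add_sub_cancel]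
  obtain ⟨θ, hθ⟩ := exists_hom_of_nsmul (d := d) (F 1 0 - F 0 0) (by
    rw [hd]
    exact gcd_nsmul_eq_zero (nsmul_eq_zero_of_forall_add_one (fun a => F a 0) _ hFs)
      (nsmul_eq_zero_of_forall_add_one (H 0) _ (hHs 0)))
  refine ⟨θ, fun a j => ?_, fun a k => ?_⟩
  · rw [hF0]
    exact eq_add_of_forall_add_one (fun a => F a 0)
      (θ.comp (ZMod.castHom hdp (ZMod d)).toAddMonoidHom) (fun a => by simp [hFs, hθ, -ZMod.castHom_apply]) (a - j)
  · exact eq_add_of_forall_add_one (H a)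
      (θ.comp (ZMod.castHom hdq (ZMod d)).toAddMonoidHom) (fun k => by simp [hHs, hθ, -ZMod.castHom_apply]) k

/-- The edges that start in a cycle of length two in which the shifts are labelled by two cycles:
solution of the square relations. -/
theorem exists_shift_hom_two {p q : ℕ} [NeZero p] [NeZero q] (F : ZMod 2 → ZMod p → A)
    (H : ZMod 2 → ZMod q → A)
    (hFF : ∀ a i j, F a i + F (a + 1) j = F a j + F (a + 1) i)
    (hHH : ∀ a i j, H a i + H (a + 1) j = H a j + H (a + 1) i)
    (hFH : ∀ a i k, F a i + H (a + 1) k = H a k + F (a + 1) (i + 1))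
    (hHF : ∀ a i k, H a k + F (a + 1) i = F a i + H (a + 1) (k + 1))
    {d : ℕ} (hd : d = Nat.gcd (Nat.gcd p q) 2) (hdp : d ∣ p) (hdq : d ∣ q) (hd2 : d ∣ 2) :
    ∃ θ : ZMod d →+ A, (∀ a i, F a i = F a 0 + θ (ZMod.castHom hdp (ZMod d) i)) ∧
      ∀ a k, H a k = F a 0 + (H 0 0 - F 0 0) +
        θ (ZMod.castHom hd2 (ZMod d) a + ZMod.castHom hdq (ZMod d) k) := by
  have h2 : (1 + 1 : ZMod 2) = 0 := by decide
  -- `hFF` moves the label `i + 1` to the vertex `a + 1`, and `hFH` brings it back to `a` with label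
  -- `i`.
  have hF : ∀ a i, F a (i + 1) = F a i + ((F a 0 - H a 0) - (F (a + 1) 0 - H (a + 1) 0)) := by
    intro a i
    have e1 := hFH a i 0
    have e2 := hFF a (i + 1) 0
    have e3 : F a (i + 1) = F a 0 + F (a + 1) (i + 1) - F (a + 1) 0 := by rw [← e2]; abel
    have e4 : F (a + 1) (i + 1) = F a i + H (a + 1) 0 - H a 0 := by rw [e1]; abel
    rw [e3, e4]; abel
  have hH : ∀ a k, H a (k + 1) = H a k - ((F a 0 - H a 0) - (F (a + 1) 0 - H (a + 1) 0)) := by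
    intro a k
    have e1 := hHF a 0 k
    have e2 := hHH a (k + 1) 0
    have e3 : H a (k + 1) = H a 0 + H (a + 1) (k + 1) - H (a + 1) 0 := by rw [← e2]; abel
    have e4 : H (a + 1) (k + 1) = H a k + F (a + 1) 0 - F a 0 := by rw [e1]; abel
    rw [e3, e4]; abel
  set θ₀ : A := (F 0 0 - H 0 0) - (F 1 0 - H 1 0) with hθ₀
  -- The increments at the two vertices are opposite because `a + 2 = a`, and `hFF` for the labels
  -- `1` and `0` makes them equal. Hence the common increment has order dividing `2`.
  have hneg : (F 1 0 - H 1 0) - (F 0 0 - H 0 0) = θ₀ := by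
    have e := hFF 0 1 0
    have e1 := hF 0 0
    have e2 := hF 1 0
    simp only [zero_add, h2] at e e1 e2
    rw [e1, e2] at e
    have : F 0 0 + (F 0 0 - H 0 0 - (F 1 0 - H 1 0)) + F 1 0 - F 0 0 - F 1 0 =
      F 1 0 - H 1 0 - (F 0 0 - H 0 0) := by rw [e]; abel
    rw [← this, hθ₀]; abel
  have h2θ : 2 • θ₀ = 0 := by
    rw [two_nsmul]; nth_rw 1 [← hneg]; rw [hθ₀]; abel
  have hθneg : -θ₀ = θ₀ := by
    rw [neg_eq_iff_add_eq_zero, ← two_nsmul, h2θ]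
  have hu : ∀ a : ZMod 2, (F a 0 - H a 0) - (F (a + 1) 0 - H (a + 1) 0) = θ₀ := by
    intro a
    fin_cases a
    · change F 0 0 - H 0 0 - (F (0 + 1) 0 - H (0 + 1) 0) = θ₀
      rw [zero_add]
    · change F 1 0 - H 1 0 - (F (1 + 1) 0 - H (1 + 1) 0) = θ₀
      rw [h2, hneg]
  have hFs : ∀ a i, F a (i + 1) = F a i + θ₀ := fun a i => by rw [hF, hu]
  have hHs : ∀ a k, H a (k + 1) = H a k + θ₀ := fun a k => by
    rw [hH, hu, sub_eq_add_neg, hθneg]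
  obtain ⟨θ, hθ⟩ := exists_hom_of_nsmul (d := d) θ₀ (by
    rw [hd]
    exact gcd_nsmul_eq_zero (gcd_nsmul_eq_zero (nsmul_eq_zero_of_forall_add_one (F 0) _ (hFs 0))
      (nsmul_eq_zero_of_forall_add_one (H 0) _ (hHs 0))) h2θ)
  refine ⟨θ, fun a i => ?_, fun a k => ?_⟩
  · exact eq_add_of_forall_add_one (F a)
      (θ.comp (ZMod.castHom hdp (ZMod d)).toAddMonoidHom) (fun a => by simp [hFs, hθ, -ZMod.castHom_apply]) i
  · have e1 : H a k = H a 0 + θ (ZMod.castHom hdq (ZMod d) k) :=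
      eq_add_of_forall_add_one (H a)
        (θ.comp (ZMod.castHom hdq (ZMod d)).toAddMonoidHom) (fun a => by simp [hHs, hθ, -ZMod.castHom_apply]) k
    -- Passing to the other vertex changes `H - F` by exactly the increment `θ₀`; this is the source
    -- of the summand `a` in the argument of `θ`.
    have e2 : H a 0 - F a 0 = H 0 0 - F 0 0 + θ (ZMod.castHom hd2 (ZMod d) a) := by
      refine eq_add_of_forall_add_one (fun a => H a 0 - F a 0)
        (θ.comp (ZMod.castHom hd2 (ZMod d)).toAddMonoidHom) (fun a => ?_) a
      simp only [AddMonoidHom.comp_apply, RingHom.toAddMonoidHom_eq_coe, AddMonoidHom.coe_coe,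
        map_one, hθ]
      rw [← hu a]; abel
    rw [map_add, add_assoc, ← add_assoc (H 0 0 - F 0 0), ← e2, e1]
    abel

end ZMod

end AbQuandle

namespace AbQuandle

/-! ### Cycles of a single orbit. -/

section OrbitClasses

variable {A B : Type*} [AddCommGroup A] [AddCommGroup B]

/-- The cycles of one orbit with three free generators and a cyclic torsion part. -/
def orbitCycles {d : ℕ} (F C Z : A) (θ : ZMod d →+ A) : ℤ × ℤ × ℤ × ZMod d →+ A :=
  (zmultiplesHom A F).coprod ((zmultiplesHom A C).coprod ((zmultiplesHom A Z).coprod θ))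

theorem orbitCycles_apply {d : ℕ} (F C Z : A) (θ : ZMod d →+ A) (f c z : ℤ) (t : ZMod d) :
    orbitCycles F C Z θ (f, c, z, t) = f • F + (c • C + (z • Z + θ t)) := by
  simp [orbitCycles]

theorem comp_eq_of_one {d : ℕ} (f g : ZMod d →+ B) (h : f 1 = g 1) : f = g := by
  ext k
  obtain ⟨k, rfl⟩ := ZMod.intCast_surjective k
  rw [← zsmul_one, map_zsmul, map_zsmul, h]

/-- Homomorphisms out of the group of cycles of one orbit are determined by four generators. This
reduces the computation of projections and boundaries to four values each. -/
theorem map_orbitCycles_eq {d : ℕ} {F C Z : A} {θ : ZMod d →+ A} (φ : A →+ B)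
    (ι : ℤ × ℤ × ℤ × ZMod d →+ B) (hF : φ F = ι (1, 0, 0, 0)) (hC : φ C = ι (0, 1, 0, 0))
    (hZ : φ Z = ι (0, 0, 1, 0)) (hθ : φ (θ 1) = ι (0, 0, 0, 1)) (k : ℤ × ℤ × ℤ × ZMod d) :
    φ (orbitCycles F C Z θ k) = ι k := by
  obtain ⟨f, c, z, t⟩ := k
  let κ : ZMod d →+ ℤ × ℤ × ℤ × ZMod d :=
    (AddMonoidHom.inr _ _).comp ((AddMonoidHom.inr _ _).comp (AddMonoidHom.inr _ _))
  have h1 : φ (θ t) = ι (0, 0, 0, t) :=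
    DFunLike.congr_fun (comp_eq_of_one (φ.comp θ) (ι.comp κ) hθ) t
  rw [orbitCycles_apply]
  simp only [map_add, map_zsmul, h1, hF, hC, hZ]
  simp only [← map_zsmul, ← map_add]
  simp

theorem map_orbitCycles_eq_zero {d : ℕ} {F C Z : A} {θ : ZMod d →+ A} (φ : A →+ B)
    (hF : φ F = 0) (hC : φ C = 0) (hZ : φ Z = 0) (hθ : φ (θ 1) = 0)
    (k : ℤ × ℤ × ℤ × ZMod d) : φ (orbitCycles F C Z θ k) = 0 :=
  map_orbitCycles_eq φ 0 hF hC hZ hθ k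

end OrbitClasses

namespace UStar

variable {m n : ℕ}

@[simp] theorem x_act_x (i j : ZMod m) : (x i : UStar m n) ◁ x j = x i := rfl
@[simp] theorem x_act_y (i : ZMod m) (k : ZMod n) : (x i : UStar m n) ◁ y k = x (i + 1) := rfl
@[simp] theorem x_act_z (i : ZMod m) (s : ZMod 2) : (x i : UStar m n) ◁ z s = x i := rfl
@[simp] theorem y_act_x (k : ZMod n) (i : ZMod m) : (y k : UStar m n) ◁ x i = y (k + 1) := rfl
@[simp] theorem y_act_y (k l : ZMod n) : (y k : UStar m n) ◁ y l = y k := rfl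
@[simp] theorem y_act_z (k : ZMod n) (s : ZMod 2) : (y k : UStar m n) ◁ z s = y k := rfl
@[simp] theorem z_act_x (s : ZMod 2) (i : ZMod m) : (z s : UStar m n) ◁ x i = z (s + 1) := rfl
@[simp] theorem z_act_y (s : ZMod 2) (k : ZMod n) : (z s : UStar m n) ◁ y k = z (s + 1) := rfl
@[simp] theorem z_act_z (s t : ZMod 2) : (z s : UStar m n) ◁ z t = z s := rfl

theorem orbitIndex_act (a b : UStar m n) : orbitIndex (a ◁ b) = orbitIndex a := by
  rcases a with _ | _ | _ <;> rcases b with _ | _ | _ <;> rfl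

theorem orbitIndex_invAct (a b : UStar m n) : orbitIndex (Rack.invAct b a) = orbitIndex a := by
  rcases a with _ | _ | _ <;> rcases b with _ | _ | _ <;> rfl

theorem act_right_comm (a b c : UStar m n) : (a ◁ b) ◁ c = (a ◁ c) ◁ b := by
  rcases a with _ | _ | _ <;> rcases b with _ | _ | _ <;> rcases c with _ | _ | _ <;> rfl

theorem gcd_two_dvd_left : Nat.gcd (Nat.gcd m n) 2 ∣ m :=
  (Nat.gcd_dvd_left _ _).trans (Nat.gcd_dvd_left _ _)

theorem gcd_two_dvd_right : Nat.gcd (Nat.gcd m n) 2 ∣ n :=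
  (Nat.gcd_dvd_left _ _).trans (Nat.gcd_dvd_right _ _)

/-! ### Consequences of the square relations in `U⋆`. -/

section Edges

theorem eq_of_forall_add_one {A : Type*} [AddCommGroup A] {p : ℕ} [NeZero p] (u : ZMod p → A)
    (h : ∀ t, u (t + 1) = u t) (t : ZMod p) : u t = u 0 := by
  simpa using eq_add_of_forall_add_one u 0 (by simpa using h) t

/-- A square with `x_0` shifts the label `z_s` and fixes `x_i`; a square with `y_0` shifts `x_i` and
fixes the label. -/
theorem edge_x_z [NeZero m] (i : ZMod m) (s : ZMod 2) :
    edge (x i : UStar m n) (z s) = edge (x 0) (z 0) := by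
  have h1 : ∀ s, edge (x i : UStar m n) (z (s + 1)) = edge (x i) (z s) := fun s => by
    have := edge_square (x i : UStar m n) (z s) (x 0)
    simp only [x_act_x, x_act_z, z_act_x] at this
    exact (add_left_cancel ((add_comm _ _).trans this)).symm
  have h2 : ∀ i, edge (x (i + 1) : UStar m n) (z 0) = edge (x i) (z 0) := fun i => by
    have := edge_square (x i : UStar m n) (y 0) (z 0)
    simp only [x_act_y, x_act_z, y_act_z] at this
    exact add_left_cancel (this.trans (add_comm _ _))
  exact (eq_of_forall_add_one (fun s => edge (x i : UStar m n) (z s)) h1 s).trans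
    (eq_of_forall_add_one (fun i => edge (x i : UStar m n) (z 0)) h2 i)

theorem edge_y_z [NeZero n] (k : ZMod n) (s : ZMod 2) :
    edge (y k : UStar m n) (z s) = edge (y 0) (z 0) := by
  have h1 : ∀ s, edge (y k : UStar m n) (z (s + 1)) = edge (y k) (z s) := fun s => by
    have := edge_square (y k : UStar m n) (z s) (y 0)
    simp only [y_act_y, y_act_z, z_act_y] at this
    exact (add_left_cancel ((add_comm _ _).trans this)).symm
  have h2 : ∀ k, edge (y (k + 1) : UStar m n) (z 0) = edge (y k) (z 0) := fun k => by
    have := edge_square (y k : UStar m n) (x 0) (z 0)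
    simp only [y_act_x, y_act_z, x_act_z] at this
    exact add_left_cancel (this.trans (add_comm _ _))
  exact (eq_of_forall_add_one (fun s => edge (y k : UStar m n) (z s)) h1 s).trans
    (eq_of_forall_add_one (fun k => edge (y k : UStar m n) (z 0)) h2 k)

/-- Here `x_0` moves the vertex and fellow elements `z_t` alike. One square with `x_0` last shifts
vertex and label together, the other shifts the vertex alone, so the label can be shifted alone as
well. -/
theorem edge_z_z (s t : ZMod 2) :
    edge (z s : UStar m n) (z t) = edge (z 0) (z 0) := by
  have h1 : ∀ s t, edge (z (s + 1) : UStar m n) (z t) = edge (z s) (z t) := fun s t => by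
    have := edge_square (z s : UStar m n) (x 0) (z t)
    simp only [z_act_x, z_act_z, x_act_z] at this
    exact add_left_cancel (this.trans (add_comm _ _))
  have h2 : ∀ s t, edge (z (s + 1) : UStar m n) (z (t + 1)) = edge (z s) (z t) := fun s t => by
    have := edge_square (z s : UStar m n) (z t) (x 0)
    simp only [z_act_x, z_act_z] at this
    exact (add_left_cancel ((add_comm _ _).trans this)).symm
  have h3 : ∀ t, edge (z s : UStar m n) (z (t + 1)) = edge (z s) (z t) := fun t =>
    (h1 s _).symm.trans (h2 s t)
  exact (eq_of_forall_add_one (fun t => edge (z s : UStar m n) (z t)) h3 t).trans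
    (eq_of_forall_add_one (fun s => edge (z s : UStar m n) (z 0)) (fun s => h1 s 0) s)

theorem exists_edge_x [NeZero m] [NeZero n] : ∃ θ : ZMod (Nat.gcd m n) →+ Q₂ (UStar m n),
    (∀ i j, edge (x i) (x j) = edge (x 0) (x 0) +
      θ (ZMod.castHom (Nat.gcd_dvd_left m n) _ (i - j))) ∧
    ∀ i k, edge (x i) (y k) = edge (x i) (y 0) +
      θ (ZMod.castHom (Nat.gcd_dvd_right m n) _ k) := by
  refine exists_shift_hom (fun i j => edge (x i : UStar m n) (x j))
    (fun i k => edge (x i : UStar m n) (y k)) (fun i j => ?_) (fun i k j => ?_) rfl _ _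
  · have := edge_square (x i : UStar m n) (x j) (y 0)
    simp only [x_act_x, x_act_y] at this
    exact (add_left_cancel ((add_comm _ _).trans this)).symm
  · simpa using edge_square (x i : UStar m n) (y k) (x j)

theorem exists_edge_y [NeZero m] [NeZero n] : ∃ θ : ZMod (Nat.gcd m n) →+ Q₂ (UStar m n),
    (∀ i j, edge (y i) (y j) = edge (y 0) (y 0) +
      θ (ZMod.castHom (Nat.gcd_dvd_right m n) _ (i - j))) ∧
    ∀ i k, edge (y i) (x k) = edge (y i) (x 0) +
      θ (ZMod.castHom (Nat.gcd_dvd_left m n) _ k) := by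
  refine exists_shift_hom (fun i j => edge (y i : UStar m n) (y j))
    (fun i k => edge (y i : UStar m n) (x k)) (fun i j => ?_) (fun i k j => ?_)
    (Nat.gcd_comm m n) _ _
  · have := edge_square (y i : UStar m n) (y j) (x 0)
    simp only [y_act_y, y_act_x] at this
    exact (add_left_cancel ((add_comm _ _).trans this)).symm
  · simpa using edge_square (y i : UStar m n) (x k) (y j)

theorem exists_edge_z [NeZero m] [NeZero n] : ∃ θ : ZMod (Nat.gcd (Nat.gcd m n) 2) →+ Q₂ (UStar m n),
    (∀ s i, edge (z s) (x i) = edge (z s) (x 0) + θ (ZMod.castHom gcd_two_dvd_left _ i)) ∧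
    ∀ s k, edge (z s) (y k) = edge (z s) (x 0) + (edge (z 0) (y 0) - edge (z 0) (x 0)) +
      θ (ZMod.castHom (Nat.gcd_dvd_right _ 2) _ s + ZMod.castHom gcd_two_dvd_right _ k) := by
  refine exists_shift_hom_two (fun s i => edge (z s : UStar m n) (x i))
    (fun s k => edge (z s : UStar m n) (y k)) (fun s i j => ?_) (fun s i j => ?_)
    (fun s i k => ?_) (fun s i k => ?_) rfl _ _ _
  · simpa using edge_square (z s : UStar m n) (x i) (x j)
  · simpa using edge_square (z s : UStar m n) (y i) (y j)
  · simpa using edge_square (z s : UStar m n) (x i) (y k)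
  · simpa using edge_square (z s : UStar m n) (y k) (x i)

end Edges

end UStar
end AbQuandle

namespace AbQuandle
namespace UStar
variable {m n : ℕ}
-- Projection to the cycles, and the torsion groups of `U⋆`.
section Classes

/-- The target of the isomorphism that describes the second homology group: for each orbit three
free generators and a cyclic torsion part. -/
abbrev Cycles (m n : ℕ) : Type :=
  (ℤ × ℤ × ℤ × ZMod (Nat.gcd m n)) × (ℤ × ℤ × ℤ × ZMod (Nat.gcd m n)) ×
    (ℤ × ℤ × ℤ × ZMod (Nat.gcd (Nat.gcd m n) 2))

/-- The values on the edges of the projection of `Q₂` to the cycles. -/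
def edgeClass : UStar m n → UStar m n → Cycles m n
  | x i, x j => ((1, 0, 0, ZMod.castHom (Nat.gcd_dvd_left m n) _ (i - j)), 0, 0)
  | x i, y k => ((0, lastStep i, 0, ZMod.castHom (Nat.gcd_dvd_right m n) _ k), 0, 0)
  | x _, z _ => ((0, 0, 1, 0), 0, 0)
  | y k, x i => (0, (0, lastStep k, 0, ZMod.castHom (Nat.gcd_dvd_left m n) _ i), 0)
  | y k, y l => (0, (1, 0, 0, ZMod.castHom (Nat.gcd_dvd_right m n) _ (k - l)), 0)
  | y _, z _ => (0, (0, 0, 1, 0), 0)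
  | z s, x i => (0, 0, (0, lastStep s, 0, ZMod.castHom gcd_two_dvd_left _ i))
  | z s, y k => (0, 0, (1, lastStep s, 0,
      ZMod.castHom (Nat.gcd_dvd_right _ 2) _ s + ZMod.castHom gcd_two_dvd_right _ k))
  | z _, z _ => (0, 0, (0, 0, 1, 0))

theorem two_eq_zero_of_dvd {d : ℕ} (h : d ∣ 2) : (2 : ZMod d) = 0 := by
  exact_mod_cast (ZMod.natCast_eq_zero_iff 2 d).2 h

theorem edgeClass_square (a b c : UStar m n) :
    edgeClass a b + edgeClass (a ◁ b) c = edgeClass a c + edgeClass (a ◁ c) (b ◁ c) := by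
  have h2 := two_eq_zero_of_dvd (Nat.gcd_dvd_right (Nat.gcd m n) 2)
  rcases a with i | k | s <;> rcases b with i' | k' | s' <;> rcases c with i'' | k'' | s'' <;>
    simp only [edgeClass, x_act_x, x_act_y, x_act_z, y_act_x, y_act_y, y_act_z, z_act_x, z_act_y,
      z_act_z, Prod.mk_add_mk, map_add, map_sub, map_one, Prod.mk.injEq, add_zero, zero_add,
      true_and, and_true]
  -- The square at `z_s` with labels `y_k`, `x_i` shifts both `s` and `k` on one side, and needs `2
  -- = 0` in the torsion part.
  all_goals first | abel1 | linear_combination -h2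

/-- The projection of `Q₂` to the cycles. -/
noncomputable def projection (m n : ℕ) : Q₂ (UStar m n) →+ Cycles m n :=
  liftEdges edgeClass edgeClass_square

theorem projection_edge (a b : UStar m n) : projection m n (edge a b) = edgeClass a b :=
  liftEdges_edge _ _ a b

/-- The inclusion of the part of the cycles that belongs to the first orbit. -/
def inclX : ℤ × ℤ × ℤ × ZMod (Nat.gcd m n) →+ Cycles m n := AddMonoidHom.inl _ _

/-- The inclusion of the part of the cycles that belongs to the second orbit. -/
def inclY : ℤ × ℤ × ℤ × ZMod (Nat.gcd m n) →+ Cycles m n :=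
  (AddMonoidHom.inr _ _).comp (AddMonoidHom.inl _ _)

/-- The inclusion of the part of the cycles that belongs to the third orbit. -/
def inclZ : ℤ × ℤ × ℤ × ZMod (Nat.gcd (Nat.gcd m n) 2) →+ Cycles m n :=
  (AddMonoidHom.inr _ _).comp (AddMonoidHom.inr _ _)

/-- `θ 1` is the difference of the edges `(x_0, y_1)` and `(x_0, y_0)`, whose free coordinates
cancel. -/
theorem projection_shift_x {θ : ZMod (Nat.gcd m n) →+ Q₂ (UStar m n)}
    (h : ∀ i k, edge (x i) (y k) = edge (x i) (y 0) +
      θ (ZMod.castHom (Nat.gcd_dvd_right m n) _ k)) :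
    projection m n (θ 1) = inclX (0, 0, 0, 1) := by
  have h1 := h 0 1
  rw [map_one, ← sub_eq_iff_eq_add'] at h1
  rw [← h1, map_sub, projection_edge, projection_edge]
  simp only [edgeClass, map_one, map_zero, Prod.mk_sub_mk, sub_zero, sub_self]
  rfl

theorem projection_shift_y {θ : ZMod (Nat.gcd m n) →+ Q₂ (UStar m n)}
    (h : ∀ i k, edge (y i) (x k) = edge (y i) (x 0) +
      θ (ZMod.castHom (Nat.gcd_dvd_left m n) _ k)) :
    projection m n (θ 1) = inclY (0, 0, 0, 1) := by
  have h1 := h 0 1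
  rw [map_one, ← sub_eq_iff_eq_add'] at h1
  rw [← h1, map_sub, projection_edge, projection_edge]
  simp only [edgeClass, map_one, map_zero, Prod.mk_sub_mk, sub_zero, sub_self]
  rfl

theorem projection_shift_z {θ : ZMod (Nat.gcd (Nat.gcd m n) 2) →+ Q₂ (UStar m n)}
    (h : ∀ s i, edge (z s) (x i) = edge (z s) (x 0) +
      θ (ZMod.castHom gcd_two_dvd_left _ i)) :
    projection m n (θ 1) = inclZ (0, 0, 0, 1) := by
  have h1 := h 0 1
  rw [map_one, ← sub_eq_iff_eq_add'] at h1
  rw [← h1, map_sub, projection_edge, projection_edge]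
  simp only [edgeClass, map_one, map_zero, Prod.mk_sub_mk, sub_zero, sub_self]
  rfl

/-- A coordinate of the projection is a left inverse of `θ`. So the square relations impose no order
on `θ 1` smaller than `d`. -/
theorem injective_of_projection {d : ℕ} {θ : ZMod d →+ Q₂ (UStar m n)}
    (π : Cycles m n →+ ZMod d) (h : π (projection m n (θ 1)) = 1) : Function.Injective θ := by
  have key : (π.comp (projection m n)).comp θ = AddMonoidHom.id _ :=
    comp_eq_of_one _ _ h
  exact Function.LeftInverse.injective (g := π.comp (projection m n))
    (DFunLike.congr_fun key)

theorem nonempty_torsionGroup_x [NeZero m] [NeZero n] (i : ZMod m) :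
    Nonempty (torsionGroup (x i : UStar m n) ≃+ ZMod (Nat.gcd m n)) := by
  obtain ⟨θ, h1, h2⟩ := exists_edge_x (m := m) (n := n)
  refine nonempty_torsionGroup_equiv (S := {a | orbitIndex a = 0}) θ
    (fun a ha b => (orbitIndex_act a b).trans ha) (fun a ha b => (orbitIndex_invAct a b).trans ha)
    (fun a _ b c => act_right_comm a b c) ?_ ?_ rfl ?_
  · rintro (i | k | s) ha b c
    · have e1 : ∀ j l, edge (x i : UStar m n) (x j) - edge (x i) (x l) ∈ θ.range := by
        intro j l
        rw [h1 i j, h1 i l, add_sub_add_left_eq_sub, ← map_sub]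
        exact ⟨_, rfl⟩
      have e2 : ∀ j l, edge (x i : UStar m n) (y j) - edge (x i) (y l) ∈ θ.range := by
        intro j l
        rw [h2 i j, h2 i l, add_sub_add_left_eq_sub, ← map_sub]
        exact ⟨_, rfl⟩
      -- The labels `b ◁ c` and `b` lie in the same orbit, so only edges with labels of one kind are
      -- compared.
      rcases b with j | l | t <;> rcases c with j' | l' | t' <;>
        simp only [x_act_x, x_act_y, x_act_z, y_act_x, y_act_y, y_act_z, z_act_x, z_act_y,
          z_act_z, edge_x_z, sub_self, zero_mem, e1, e2]
    · exact absurd ha (by decide : (1 : Fin 3) ≠ 0)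
    · exact absurd ha (by decide : (2 : Fin 3) ≠ 0)
  · refine injective_of_projection ((AddMonoidHom.snd _ _).comp ((AddMonoidHom.snd _ _).comp
      ((AddMonoidHom.snd _ _).comp (AddMonoidHom.fst _ _)))) ?_
    rw [projection_shift_x h2]
    rfl
  -- `x_0` takes the label `y_0` to `y_1`, so this difference of parallel edges is exactly `θ 1`.
  · have h := edge_sub_edge_mem_torsionGroup (a := (x i : UStar m n)) (b := y 0) (c := x 0) rfl
    rw [y_act_x, zero_add, h2 i 1, add_sub_cancel_left, map_one] at h
    exact h

theorem nonempty_torsionGroup_y [NeZero m] [NeZero n] (k : ZMod n) :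
    Nonempty (torsionGroup (y k : UStar m n) ≃+ ZMod (Nat.gcd m n)) := by
  obtain ⟨θ, h1, h2⟩ := exists_edge_y (m := m) (n := n)
  refine nonempty_torsionGroup_equiv (S := {a | orbitIndex a = 1}) θ
    (fun a ha b => (orbitIndex_act a b).trans ha) (fun a ha b => (orbitIndex_invAct a b).trans ha)
    (fun a _ b c => act_right_comm a b c) ?_ ?_ rfl ?_
  · rintro (i | k | s) ha b c
    · exact absurd ha (by decide : (0 : Fin 3) ≠ 1)
    · have e1 : ∀ j l, edge (y k : UStar m n) (y j) - edge (y k) (y l) ∈ θ.range := by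
        intro j l
        rw [h1 k j, h1 k l, add_sub_add_left_eq_sub, ← map_sub]
        exact ⟨_, rfl⟩
      have e2 : ∀ j l, edge (y k : UStar m n) (x j) - edge (y k) (x l) ∈ θ.range := by
        intro j l
        rw [h2 k j, h2 k l, add_sub_add_left_eq_sub, ← map_sub]
        exact ⟨_, rfl⟩
      rcases b with j | l | t <;> rcases c with j' | l' | t' <;>
        simp only [x_act_x, x_act_y, x_act_z, y_act_x, y_act_y, y_act_z, z_act_x, z_act_y,
          z_act_z, edge_y_z, sub_self, zero_mem, e1, e2]
    · exact absurd ha (by decide : (2 : Fin 3) ≠ 1)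
  · refine injective_of_projection ((AddMonoidHom.snd _ _).comp ((AddMonoidHom.snd _ _).comp
      ((AddMonoidHom.snd _ _).comp ((AddMonoidHom.fst _ _).comp (AddMonoidHom.snd _ _))))) ?_
    rw [projection_shift_y h2]
    rfl
  · have h := edge_sub_edge_mem_torsionGroup (a := (y k : UStar m n)) (b := x 0) (c := y 0) rfl
    rw [x_act_y, zero_add, h2 k 1, add_sub_cancel_left, map_one] at h
    exact h

theorem nonempty_torsionGroup_z [NeZero m] [NeZero n] (s : ZMod 2) :
    Nonempty (torsionGroup (z s : UStar m n) ≃+ ZMod (Nat.gcd (Nat.gcd m n) 2)) := by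
  obtain ⟨θ, h1, h2⟩ := exists_edge_z (m := m) (n := n)
  refine nonempty_torsionGroup_equiv (S := {a | orbitIndex a = 2}) θ
    (fun a ha b => (orbitIndex_act a b).trans ha) (fun a ha b => (orbitIndex_invAct a b).trans ha)
    (fun a _ b c => act_right_comm a b c) ?_ ?_ rfl ?_
  · rintro (i | k | s) ha b c
    · exact absurd ha (by decide : (0 : Fin 3) ≠ 2)
    · exact absurd ha (by decide : (1 : Fin 3) ≠ 2)
    · have e1 : ∀ j l, edge (z s : UStar m n) (x j) - edge (z s) (x l) ∈ θ.range := by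
        intro j l
        rw [h1 s j, h1 s l, add_sub_add_left_eq_sub, ← map_sub]
        exact ⟨_, rfl⟩
      have e2 : ∀ j l, edge (z s : UStar m n) (y j) - edge (z s) (y l) ∈ θ.range := by
        intro j l
        rw [h2 s j, h2 s l, add_sub_add_left_eq_sub, ← map_sub]
        exact ⟨_, rfl⟩
      rcases b with j | l | t <;> rcases c with j' | l' | t' <;>
        simp only [x_act_x, x_act_y, x_act_z, y_act_x, y_act_y, y_act_z, z_act_x, z_act_y,
          z_act_z, edge_z_z, sub_self, zero_mem, e1, e2]
  · refine injective_of_projection ((AddMonoidHom.snd _ _).comp ((AddMonoidHom.snd _ _).comp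
      ((AddMonoidHom.snd _ _).comp ((AddMonoidHom.snd _ _).comp (AddMonoidHom.snd _ _))))) ?_
    rw [projection_shift_z h1]
    rfl
  · have h := edge_sub_edge_mem_torsionGroup (a := (z s : UStar m n)) (b := x 0) (c := y 0) rfl
    rw [x_act_y, zero_add, h1 s 1, add_sub_cancel_left, map_one] at h
    exact h

/-! ### The second homology group of `U⋆`. -/

/-- A path in its orbit from the base point to the given vertex. -/
noncomputable def basePath : UStar m n → Q₂ (UStar m n)
  | x i => arcSum (fun j => edge (x j) (y 0)) i
  | y k => arcSum (fun j => edge (y j) (x 0)) k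
  | z s => arcSum (fun j => edge (z j) (x 0)) s

/-- Parallel edges have the same endpoints, so their difference is a cycle. -/
theorem boundary_shift {d : ℕ} {a b b' : UStar m n} {θ : ZMod d →+ Q₂ (UStar m n)}
    (h : edge a b' = edge a b + θ 1) (hab : a ◁ b' = a ◁ b) :
    boundary (UStar m n) (θ 1) = 0 := by
  rw [← sub_eq_iff_eq_add'.2 h, map_sub, boundary_edge, boundary_edge, hab, sub_self]

/-- The sum of the edges around a cycle. -/
noncomputable def edgeCycle {p : ℕ} (v : ZMod p → UStar m n) (b : UStar m n) : Q₂ (UStar m n) :=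
  ∑ j ∈ Finset.range p, edge (v j) b

theorem boundary_edgeCycle {p : ℕ} (v : ZMod p → UStar m n) (b : UStar m n)
    (hv : ∀ j, v j ◁ b = v (j + 1)) : boundary (UStar m n) (edgeCycle v b) = 0 := by
  rw [edgeCycle, map_sum, ← sum_shift_sub fun j => (Finsupp.single (v j) 1 : UStar m n →₀ ℤ)]
  exact Finset.sum_congr rfl fun j _ => by rw [boundary_edge, hv]

/-- Only the edge that closes the cycle is seen by the projection, so the whole cycle counts once.
-/
theorem projection_edgeCycle {p : ℕ} [NeZero p] (v : ZMod p → UStar m n) (b : UStar m n)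
    (f : ℤ →+ Cycles m n) (hf : ∀ j, edgeClass (v j) b = f (lastStep j)) :
    projection m n (edgeCycle v b) = f 1 := by
  rw [edgeCycle, map_sum, ← sum_lastStep (p := p), map_sum]
  exact Finset.sum_congr rfl fun j _ => by rw [projection_edge, hf]

theorem projection_orbitCycles_x [NeZero m] {θ : ZMod (Nat.gcd m n) →+ Q₂ (UStar m n)}
    (h : ∀ i k, edge (x i) (y k) = edge (x i) (y 0) +
      θ (ZMod.castHom (Nat.gcd_dvd_right m n) _ k))
    (k : ℤ × ℤ × ℤ × ZMod (Nat.gcd m n)) :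
    projection m n (orbitCycles (edge (x 0) (x 0)) (edgeCycle x (y 0))
      (edge (x 0) (z 0)) θ k) = inclX k :=
  map_orbitCycles_eq (projection m n) inclX
    (by rw [projection_edge]; simp only [edgeClass, sub_self, map_zero]; rfl)
    (projection_edgeCycle _ _ (inclX.comp ((AddMonoidHom.inr _ _).comp (AddMonoidHom.inl _ _)))
      fun j => by simp only [edgeClass, map_zero]; rfl)
    (projection_edge _ _) (projection_shift_x h) k

theorem boundary_orbitCycles_x {θ : ZMod (Nat.gcd m n) →+ Q₂ (UStar m n)}
    (h : ∀ i k, edge (x i) (y k) = edge (x i) (y 0) +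
      θ (ZMod.castHom (Nat.gcd_dvd_right m n) _ k))
    (k : ℤ × ℤ × ℤ × ZMod (Nat.gcd m n)) :
    boundary (UStar m n) (orbitCycles (edge (x 0) (x 0)) (edgeCycle x (y 0))
      (edge (x 0) (z 0)) θ k) = 0 := by
  have h1 := h 0 1
  rw [map_one] at h1
  refine map_orbitCycles_eq_zero (boundary (UStar m n)) ?_
    (boundary_edgeCycle _ _ fun _ => rfl) ?_ (boundary_shift h1 rfl) k
  · rw [boundary_edge]; exact sub_self _
  · rw [boundary_edge]; exact sub_self _

theorem projection_orbitCycles_y [NeZero n] {θ : ZMod (Nat.gcd m n) →+ Q₂ (UStar m n)}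
    (h : ∀ i k, edge (y i) (x k) = edge (y i) (x 0) +
      θ (ZMod.castHom (Nat.gcd_dvd_left m n) _ k))
    (k : ℤ × ℤ × ℤ × ZMod (Nat.gcd m n)) :
    projection m n (orbitCycles (edge (y 0) (y 0)) (edgeCycle y (x 0))
      (edge (y 0) (z 0)) θ k) = inclY k :=
  map_orbitCycles_eq (projection m n) inclY
    (by rw [projection_edge]; simp only [edgeClass, sub_self, map_zero]; rfl)
    (projection_edgeCycle _ _ (inclY.comp ((AddMonoidHom.inr _ _).comp (AddMonoidHom.inl _ _)))
      fun j => by simp only [edgeClass, map_zero]; rfl)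
    (projection_edge _ _) (projection_shift_y h) k

theorem boundary_orbitCycles_y {θ : ZMod (Nat.gcd m n) →+ Q₂ (UStar m n)}
    (h : ∀ i k, edge (y i) (x k) = edge (y i) (x 0) +
      θ (ZMod.castHom (Nat.gcd_dvd_left m n) _ k))
    (k : ℤ × ℤ × ℤ × ZMod (Nat.gcd m n)) :
    boundary (UStar m n) (orbitCycles (edge (y 0) (y 0)) (edgeCycle y (x 0))
      (edge (y 0) (z 0)) θ k) = 0 := by
  have h1 := h 0 1
  rw [map_one] at h1
  refine map_orbitCycles_eq_zero (boundary (UStar m n)) ?_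
    (boundary_edgeCycle _ _ fun _ => rfl) ?_ (boundary_shift h1 rfl) k
  · rw [boundary_edge]; exact sub_self _
  · rw [boundary_edge]; exact sub_self _

theorem projection_orbitCycles_z {θ : ZMod (Nat.gcd (Nat.gcd m n) 2) →+ Q₂ (UStar m n)}
    (h : ∀ s i, edge (z s) (x i) = edge (z s) (x 0) +
      θ (ZMod.castHom gcd_two_dvd_left _ i))
    (k : ℤ × ℤ × ℤ × ZMod (Nat.gcd (Nat.gcd m n) 2)) :
    projection m n (orbitCycles (edge (z 0) (y 0) - edge (z 0) (x 0)) (edgeCycle z (x 0))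
      (edge (z 0) (z 0)) θ k) = inclZ k :=
  map_orbitCycles_eq (projection m n) inclZ
    (by
      rw [map_sub, projection_edge, projection_edge]
      simp only [edgeClass, map_zero, add_zero, Prod.mk_sub_mk, sub_self, sub_zero]
      rfl)
    (projection_edgeCycle _ _ (inclZ.comp ((AddMonoidHom.inr _ _).comp (AddMonoidHom.inl _ _)))
      fun j => by simp only [edgeClass, map_zero]; rfl)
    (projection_edge _ _) (projection_shift_z h) k

theorem boundary_orbitCycles_z {θ : ZMod (Nat.gcd (Nat.gcd m n) 2) →+ Q₂ (UStar m n)}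
    (h : ∀ s i, edge (z s) (x i) = edge (z s) (x 0) +
      θ (ZMod.castHom gcd_two_dvd_left _ i))
    (k : ℤ × ℤ × ℤ × ZMod (Nat.gcd (Nat.gcd m n) 2)) :
    boundary (UStar m n) (orbitCycles (edge (z 0) (y 0) - edge (z 0) (x 0)) (edgeCycle z (x 0))
      (edge (z 0) (z 0)) θ k) = 0 := by
  have h1 := h 0 1
  rw [map_one] at h1
  refine map_orbitCycles_eq_zero (boundary (UStar m n)) ?_
    (boundary_edgeCycle _ _ fun _ => rfl) ?_ (boundary_shift h1 rfl) k
  · rw [map_sub, boundary_edge, boundary_edge, z_act_x, z_act_y, sub_self]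
  · rw [boundary_edge]; exact sub_self _

theorem nonempty_H₂_equiv_cycles [NeZero m] [NeZero n] :
    Nonempty (H₂ (UStar m n) ≃+ Cycles m n) := by
  obtain ⟨θ₁, h11, h12⟩ := exists_edge_x (m := m) (n := n)
  obtain ⟨θ₂, h21, h22⟩ := exists_edge_y (m := m) (n := n)
  obtain ⟨θ₃, h31, h32⟩ := exists_edge_z (m := m) (n := n)
  let σ₁ := orbitCycles (edge (x 0) (x 0)) (edgeCycle x (y 0)) (edge (x 0) (z 0)) θ₁
  let σ₂ := orbitCycles (edge (y 0) (y 0)) (edgeCycle y (x 0)) (edge (y 0) (z 0)) θ₂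
  let σ₃ := orbitCycles (edge (z 0) (y 0) - edge (z 0) (x 0)) (edgeCycle z (x 0))
    (edge (z 0) (z 0)) θ₃
  let σ : Cycles m n →+ Q₂ (UStar m n) := σ₁.coprod (σ₂.coprod σ₃)
  have hσ_apply : ∀ k, σ k = σ₁ k.1 + (σ₂ k.2.1 + σ₃ k.2.2) := fun _ => rfl
  refine nonempty_H₂_equiv (projection m n) σ
    (Finsupp.linearCombination ℤ basePath).toAddMonoidHom ?_ ?_ ?_
  · rintro ⟨k₁, k₂, k₃⟩
    rw [hσ_apply, map_add, map_add, projection_orbitCycles_x h12, projection_orbitCycles_y h22,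
      projection_orbitCycles_z h31]
    simp [inclX, inclY, inclZ]
  · rintro ⟨k₁, k₂, k₃⟩
    rw [hσ_apply, map_add, map_add, boundary_orbitCycles_x h12, boundary_orbitCycles_y h22,
      boundary_orbitCycles_z h31, add_zero, add_zero]
  · intro a b
    have hτ : (Finsupp.linearCombination ℤ basePath).toAddMonoidHom
        (boundary (UStar m n) (edge a b)) = basePath (a ◁ b) - basePath a := by
      rw [boundary_edge, map_sub]; simp
    rw [hτ, hσ_apply, projection_edge]
    -- For loops the path term cancels. The remaining edges split by `arcSum_add_one`; at `z_s` the
    -- edges labelled `y` are first compared with those labelled `x_0`, along which the base paths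
    -- run.
    rcases a with i | k | s <;> rcases b with j | l | t <;>
      simp only [edgeClass, x_act_x, x_act_y, x_act_z, y_act_x, y_act_y, y_act_z, z_act_x,
        z_act_y, z_act_z, map_zero, add_zero, zero_add, sub_self,
        σ₁, σ₂, σ₃, orbitCycles_apply, zero_smul, one_smul, basePath]
    · exact h11 i j
    · rw [h12, arcSum_add_one (fun j => edge (x j : UStar m n) (y 0)) i]
      rw [edgeCycle]
      abel
    · exact edge_x_z i t
    · rw [h22, arcSum_add_one (fun j => edge (y j : UStar m n) (x 0)) k]
      rw [edgeCycle]
      abel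
    · exact h21 k l
    · exact edge_y_z k t
    · rw [h31, arcSum_add_one (fun j => edge (z j : UStar m n) (x 0)) s]
      rw [edgeCycle]
      abel
    · rw [h32, arcSum_add_one (fun j => edge (z j : UStar m n) (x 0)) s]
      rw [edgeCycle]
      abel
    · exact edge_z_z s t

/-- The components of the cycles in another order. -/
def cyclesEquiv : Cycles m n ≃+
    (Fin 9 → ℤ) × (Fin 2 → ZMod (Nat.gcd m n)) × ZMod (Nat.gcd (Nat.gcd m n) 2) where
  toFun k := (![k.1.1, k.1.2.1, k.1.2.2.1, k.2.1.1, k.2.1.2.1, k.2.1.2.2.1,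
    k.2.2.1, k.2.2.2.1, k.2.2.2.2.1], ![k.1.2.2.2, k.2.1.2.2.2], k.2.2.2.2.2)
  invFun v := ((v.1 0, v.1 1, v.1 2, v.2.1 0), (v.1 3, v.1 4, v.1 5, v.2.1 1),
    (v.1 6, v.1 7, v.1 8, v.2.2))
  left_inv _ := rfl
  right_inv v := by
    refine Prod.ext ?_ (Prod.ext ?_ rfl) <;> funext i <;> fin_cases i <;> rfl
  map_add' k l := by
    refine Prod.ext ?_ (Prod.ext ?_ rfl) <;> funext i <;> fin_cases i <;> rfl

end Classes
end UStar
end AbQuandle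


namespace AbQuandle

/-! ### Groups `G(M)` as cyclic groups. -/

section Parameters

theorem paramOrbit_addSubgroup_eq_top {s : ℕ} {M : Matrix (Fin s) (Fin s) ℕ}
    (H : AddSubgroup (ParamOrbit M)) (h : ∀ k, paramGen M k ∈ H) (q : ParamOrbit M) : q ∈ H := by
  obtain ⟨w, rfl⟩ := QuotientAddGroup.mk_surjective q
  have hw : w = ∑ k, w k • (Pi.single k 1 : Fin s → ℤ) := by
    funext j
    simp [Finset.sum_apply, Pi.single_apply]
  have key : (QuotientAddGroup.mk' _ w : ParamOrbit M) ∈ H := by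
    rw [hw, map_sum]
    refine sum_mem fun k _ => ?_
    rw [map_zsmul]
    exact zsmul_mem (by simpa [paramGen] using h k.succ) _
  exact key

/-- A component of a filtered-permutation quandle that is isomorphic to a cycle on which the
elements of each orbit act by a fixed shift. -/
theorem exists_paramOrbit_equiv {s d : ℕ} {X : Type*} [Quandle X] {o : X → Fin (s + 1)}
    {M : Fin (s + 1) → Matrix (Fin s) (Fin s) ℕ} (e : X ≃ FPQuandle M)
    (he : ∀ a b, e (a ◁ b) = e a ◁ e b) (ho : ∀ a, (e a).index = o a) (i : Fin (s + 1))
    (v : ZMod d → X) (hv : Function.Injective v) (hvo : ∀ t, o (v t) = i)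
    (hvs : ∀ a, o a = i → ∃ t, v t = a) (c : Fin (s + 1) → ZMod d)
    (hc : ∀ t b, v t ◁ b = v (t + c (o b))) :
    ∃ ε : ParamOrbit (M i) ≃+ ZMod d, ∀ j, ε (paramGen (M i) (j - i)) = c j := by
  have hex : ∀ p : ParamOrbit (M i), ∃ t, v t = e.symm ⟨i, p⟩ := fun p =>
    hvs _ (by rw [← ho, Equiv.apply_symm_apply])
  choose ψ hψ using hex
  -- Any element of the `j`-th component acts in the same way, so the neutral one is used as the
  -- label.
  have hgen : ∀ j p, ψ (p + paramGen (M i) (j - i)) = ψ p + c j := by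
    intro j p
    apply hv
    have h1 : o (e.symm ⟨j, 0⟩) = j := by rw [← ho, Equiv.apply_symm_apply]
    have h2 := hc (ψ p) (e.symm ⟨j, 0⟩)
    rw [h1, hψ] at h2
    rw [hψ, ← h2, Equiv.symm_apply_eq, he, Equiv.apply_symm_apply, Equiv.apply_symm_apply]
    rfl
  -- The elements whose translation corresponds to a translation of the cycle form a subgroup. It
  -- contains all generators, hence `ψ` is a homomorphism up to the constant `ψ 0`.
  let H : AddSubgroup (ParamOrbit (M i)) :=
    { carrier := {q | ∃ t, ∀ p, ψ (p + q) = ψ p + t}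
      zero_mem' := ⟨0, by simp⟩
      add_mem' := by
        rintro q q' ⟨t, ht⟩ ⟨t', ht'⟩
        exact ⟨t + t', fun p => by rw [← add_assoc, ht', ht, add_assoc]⟩
      neg_mem' := by
        rintro q ⟨t, ht⟩
        refine ⟨-t, fun p => ?_⟩
        have := ht (p + -q)
        rw [neg_add_cancel_right] at this
        rw [this, add_neg_cancel_right] }
  have hadd : ∀ p q, ψ (p + q) = ψ p + (ψ q - ψ 0) := by
    intro p q
    obtain ⟨t, ht⟩ := paramOrbit_addSubgroup_eq_top H (fun k => ⟨c (k + i), fun p => by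
      simpa using hgen (k + i) p⟩) q
    have h0 := ht 0
    rw [zero_add] at h0
    rw [ht, h0, add_sub_cancel_left]
  let ε : ParamOrbit (M i) →+ ZMod d := AddMonoidHom.mk' (fun p => ψ p - ψ 0) fun p q => by
    rw [hadd]; abel
  have hinj : Function.Injective ε := by
    intro p q hpq
    have h1 : ψ p = ψ q := sub_left_injective hpq
    have h2 := congrArg v h1
    rw [hψ, hψ, e.symm.injective.eq_iff] at h2
    exact eq_of_heq (FPQuandle.mk.inj h2).2
  have hsurj : Function.Surjective ε := by
    intro t
    have hi : (e (v (t + ψ 0))).index = i := by rw [ho, hvo]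
    have hp : ∃ p, e (v (t + ψ 0)) = ⟨i, p⟩ := by
      generalize e (v (t + ψ 0)) = w at hi
      obtain ⟨i', p⟩ := w
      obtain rfl : i' = i := hi
      exact ⟨p, rfl⟩
    obtain ⟨p, hp⟩ := hp
    refine ⟨p, ?_⟩
    have h1 : v (ψ p) = v (t + ψ 0) := by rw [hψ, ← hp, Equiv.symm_apply_apply]
    exact sub_eq_of_eq_add (hv h1)
  refine ⟨AddEquiv.ofBijective ε ⟨hinj, hsurj⟩, fun j => ?_⟩
  have := hgen j 0
  rw [zero_add] at this
  change ψ _ - ψ 0 = c j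
  rw [this, add_sub_cancel_left]

/-- Recognition of the group `G(M)` for two generators as a cyclic group. -/
theorem exists_paramOrbit_two_equiv {d : ℕ} (M : Matrix (Fin 2) (Fin 2) ℕ) (u v : ZMod d)
    (hrel : ∀ i, (M i 0 : ZMod d) * u + M i 1 * v = 0)
    (hker : ∀ a b : ℤ, (a * u + b * v : ZMod d) = 0 →
      ∃ k l : ℤ, a = k * M 0 0 + l * M 1 0 ∧ b = k * M 0 1 + l * M 1 1)
    (hsurj : ∀ t, ∃ a b : ℤ, (a * u + b * v : ZMod d) = t) :
    ∃ ε : ParamOrbit M ≃+ ZMod d, ε (paramGen M 0) = 0 ∧ ε (paramGen M 1) = u ∧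
      ε (paramGen M 2) = v := by
  let f : (Fin 2 → ℤ) →+ ZMod d := AddMonoidHom.mk' (fun w => (w 0 : ZMod d) * u + w 1 * v) (by
    intro w w'
    simp only [Pi.add_apply, Int.cast_add]
    ring)
  have hf : AddSubgroup.closure (Set.range fun i : Fin 2 => fun j : Fin 2 => (M i j : ℤ)) =
      f.ker := by
    apply le_antisymm
    · rw [AddSubgroup.closure_le]
      rintro _ ⟨i, rfl⟩
      change (((M i 0 : ℕ) : ℤ) : ZMod d) * u + ((M i 1 : ℕ) : ℤ) * v = 0
      simpa using hrel i
    · intro w hw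
      obtain ⟨k, l, hk, hl⟩ := hker (w 0) (w 1) hw
      have : w = k • (fun j => (M 0 j : ℤ)) + l • (fun j => (M 1 j : ℤ)) := by
        funext j
        fin_cases j
        · simpa using hk
        · simpa using hl
      rw [this]
      refine add_mem (zsmul_mem ?_ _) (zsmul_mem ?_ _)
      · exact AddSubgroup.subset_closure ⟨0, rfl⟩
      · exact AddSubgroup.subset_closure ⟨1, rfl⟩
  have hfs : Function.Surjective f := fun t => by
    obtain ⟨a, b, h⟩ := hsurj t
    exact ⟨![a, b], h⟩
  refine ⟨(QuotientAddGroup.quotientAddEquivOfEq hf).trans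
    (QuotientAddGroup.quotientKerEquivOfSurjective f hfs), map_zero _, ?_, ?_⟩
  · change ((Pi.single (0 : Fin 2) (1 : ℤ) : Fin 2 → ℤ) 0 : ZMod d) * u +
      ((Pi.single (0 : Fin 2) (1 : ℤ) : Fin 2 → ℤ) 1 : ZMod d) * v = u
    simp
  · change ((Pi.single (1 : Fin 2) (1 : ℤ) : Fin 2 → ℤ) 0 : ZMod d) * u +
      ((Pi.single (1 : Fin 2) (1 : ℤ) : Fin 2 → ℤ) 1 : ZMod d) * v = v
    simp

/-- The Chinese remainder theorem for moduli that need not be coprime: Bézout writes the difference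
of the residues, a multiple of the gcd, as a multiple of `m` plus a multiple of `n`. -/
theorem exists_int_cast_eq {m n : ℕ} (a : ZMod m) (b : ZMod n)
    (h : ZMod.castHom (Nat.gcd_dvd_left m n) (ZMod (Nat.gcd m n)) a =
      ZMod.castHom (Nat.gcd_dvd_right m n) (ZMod (Nat.gcd m n)) b) :
    ∃ t : ℤ, (t : ZMod m) = a ∧ (t : ZMod n) = b := by
  obtain ⟨a, rfl⟩ := ZMod.intCast_surjective a
  obtain ⟨b, rfl⟩ := ZMod.intCast_surjective b
  rw [map_intCast, map_intCast, ZMod.intCast_eq_intCast_iff_dvd_sub] at h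
  obtain ⟨k, hk⟩ := h
  have hg := Nat.gcd_eq_gcd_ab m n
  rw [hg] at hk
  refine ⟨a + m * (Nat.gcdA m n * k), by simp, ?_⟩
  have : a + m * (Nat.gcdA m n * k) = b - n * (Nat.gcdB m n * k) := by linear_combination -hk
  rw [this]
  simp

end Parameters

/-! ### Parameters and parameter group of `U⋆`. -/

namespace UStar

variable {m n : ℕ}

theorem exists_hasParameters (hm : 1 ≤ m) (hn : 1 ≤ n) :
    ∃ M : Fin 3 → Matrix (Fin 2) (Fin 2) ℕ, HasParameters (UStar m n) orbitIndex M := by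
  -- On the `i`-th orbit `x_1` and `x_2` are the shifts by the next two orbits in cyclic order. For
  -- `x` these are `y`, `z`; for `y` they are `z`, `x`; for `z` they are `x`, `y`, both acting as
  -- the same involution, whence `x_1² = 1` and `x_1 x_2 = 1`.
  refine ⟨![!![m, 0; 0, 1], !![1, 0; 0, n], !![2, 0; 1, 1]], ?_, ?_⟩
  · intro i
    fin_cases i <;> refine ⟨fun i => ?_, fun i j h => ?_, fun i j h => ?_⟩ <;> fin_cases i <;>
      (try fin_cases j) <;> simp_all
    omega
  set M : Fin 3 → Matrix (Fin 2) (Fin 2) ℕ := ![!![m, 0; 0, 1], !![1, 0; 0, n], !![2, 0; 1, 1]]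
  obtain ⟨ε₀, h00, h01, h02⟩ := exists_paramOrbit_two_equiv (d := m) (M 0) 1 0
    (fun i => by fin_cases i <;> simp [M])
    (fun a b h => by
      rw [mul_one, mul_zero, add_zero, ZMod.intCast_zmod_eq_zero_iff_dvd] at h
      obtain ⟨k, rfl⟩ := h
      exact ⟨k, b, by simp [M, mul_comm], by simp [M]⟩)
    (fun t => by
      obtain ⟨t, rfl⟩ := ZMod.intCast_surjective t
      exact ⟨t, 0, by simp⟩)
  obtain ⟨ε₁, h10, h11, h12⟩ := exists_paramOrbit_two_equiv (d := n) (M 1) 0 1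
    (fun i => by fin_cases i <;> simp [M])
    (fun a b h => by
      rw [mul_one, mul_zero, zero_add, ZMod.intCast_zmod_eq_zero_iff_dvd] at h
      obtain ⟨k, rfl⟩ := h
      exact ⟨a, k, by simp [M], by simp [M, mul_comm]⟩)
    (fun t => by
      obtain ⟨t, rfl⟩ := ZMod.intCast_surjective t
      exact ⟨0, t, by simp⟩)
  obtain ⟨ε₂, h20, h21, h22⟩ := exists_paramOrbit_two_equiv (d := 2) (M 2) 1 1
    (fun i => by fin_cases i <;> simp [M] <;> decide)
    (fun a b h => by
      have h' : ((a + b : ℤ) : ZMod 2) = 0 := by simpa using h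
      rw [ZMod.intCast_zmod_eq_zero_iff_dvd] at h'
      obtain ⟨k, hk⟩ := h'
      push_cast at hk
      -- From `a + b = 2k` the remainder after `b` copies of the row `(1, 1)` is `a - b = 2(k - b)`.
      exact ⟨k - b, b, by simp [M]; linarith, by simp [M]⟩)
    (fun t => by
      obtain ⟨t, rfl⟩ := ZMod.intCast_surjective t
      exact ⟨t, 0, by simp⟩)
  let f : UStar m n → FPQuandle M
    | x i => ⟨0, ε₀.symm i⟩
    | y k => ⟨1, ε₁.symm k⟩
    | z s => ⟨2, ε₂.symm s⟩
  have hinj : Function.Injective f := by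
    rintro (i | k | s) (i' | k' | s') h <;> obtain ⟨h1, h2⟩ := FPQuandle.mk.inj h
    all_goals first
      | exact absurd h1 (by decide)
      | rw [(AddEquiv.injective _) (eq_of_heq h2)]
  have hsurj : Function.Surjective f := by
    rintro ⟨i, p⟩
    fin_cases i
    · exact ⟨x (ε₀ p), congrArg (FPQuandle.mk (M := M) 0) (ε₀.symm_apply_apply p)⟩
    · exact ⟨y (ε₁ p), congrArg (FPQuandle.mk (M := M) 1) (ε₁.symm_apply_apply p)⟩
    · exact ⟨z (ε₂ p), congrArg (FPQuandle.mk (M := M) 2) (ε₂.symm_apply_apply p)⟩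
  refine ⟨Equiv.ofBijective f ⟨hinj, hsurj⟩, ?_, ?_⟩
  · have key₀ : ∀ t (k : Fin 3) c, ε₀ (paramGen (M 0) k) = c →
        ε₀.symm (t + c) = ε₀.symm t + paramGen (M 0) k := by
      rintro t k c rfl
      rw [map_add, AddEquiv.symm_apply_apply]
    have key₁ : ∀ t (k : Fin 3) c, ε₁ (paramGen (M 1) k) = c →
        ε₁.symm (t + c) = ε₁.symm t + paramGen (M 1) k := by
      rintro t k c rfl
      rw [map_add, AddEquiv.symm_apply_apply]
    have key₂ : ∀ t (k : Fin 3) c, ε₂ (paramGen (M 2) k) = c →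
        ε₂.symm (t + c) = ε₂.symm t + paramGen (M 2) k := by
      rintro t k c rfl
      rw [map_add, AddEquiv.symm_apply_apply]
    rintro (i | k | s) (i' | k' | s')
    · exact congrArg (FPQuandle.mk 0) ((congrArg ε₀.symm (add_zero _)).symm.trans (key₀ i 0 0 h00))
    · exact congrArg (FPQuandle.mk 0) (key₀ i 1 1 h01)
    · exact congrArg (FPQuandle.mk 0) ((congrArg ε₀.symm (add_zero _)).symm.trans (key₀ i 2 0 h02))
    · exact congrArg (FPQuandle.mk 1) (key₁ k 2 1 h12)
    · exact congrArg (FPQuandle.mk 1) ((congrArg ε₁.symm (add_zero _)).symm.trans (key₁ k 0 0 h10))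
    · exact congrArg (FPQuandle.mk 1) ((congrArg ε₁.symm (add_zero _)).symm.trans (key₁ k 1 0 h11))
    · exact congrArg (FPQuandle.mk 2) (key₂ s 1 1 h21)
    · exact congrArg (FPQuandle.mk 2) (key₂ s 2 1 h22)
    · exact congrArg (FPQuandle.mk 2) ((congrArg ε₂.symm (add_zero _)).symm.trans (key₂ s 0 0 h20))
  · rintro (_ | _ | _) <;> rfl

/-- The argument works for whatever parameters are given, so their uniqueness is not needed: the
quandle isomorphism alone determines the groups and how their generators shift. -/
theorem nonempty_parameterGroup_equiv {M : Fin 3 → Matrix (Fin 2) (Fin 2) ℕ}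
    (h : HasParameters (UStar m n) orbitIndex M) :
    Nonempty (ParameterGroup M ≃+ ZMod (Nat.gcd m n)) := by
  obtain ⟨-, e, he, ho⟩ := h
  obtain ⟨ε₀, h₀⟩ := exists_paramOrbit_equiv e he ho 0 x (fun _ _ h => UStar.x.inj h)
    (fun _ => rfl) (by
      rintro (i | k | s) h
      · exact ⟨i, rfl⟩
      · exact absurd h (by simp [orbitIndex])
      · exact absurd h (by simp [orbitIndex])) ![0, 1, 0]
    (by rintro t (_ | _ | _) <;> simp [orbitIndex])
  obtain ⟨ε₁, h₁⟩ := exists_paramOrbit_equiv e he ho 1 y (fun _ _ h => UStar.y.inj h)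
    (fun _ => rfl) (by
      rintro (i | k | s) h
      · exact absurd h (by simp [orbitIndex])
      · exact ⟨k, rfl⟩
      · exact absurd h (by simp [orbitIndex])) ![1, 0, 0]
    (by rintro t (_ | _ | _) <;> simp [orbitIndex])
  obtain ⟨ε₂, h₂⟩ := exists_paramOrbit_equiv e he ho 2 z (fun _ _ h => UStar.z.inj h)
    (fun _ => rfl) (by
      rintro (i | k | s) h
      · exact absurd h (by simp [orbitIndex])
      · exact absurd h (by simp [orbitIndex])
      · exact ⟨s, rfl⟩) ![1, 1, 0]
    (by rintro t (_ | _ | _) <;> simp [orbitIndex])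
  have e01 : ε₀ (paramGen (M 0) (1 - 0)) = 1 := h₀ 1
  have e02 : ε₀ (paramGen (M 0) (2 - 0)) = 0 := h₀ 2
  have e10 : ε₁ (paramGen (M 1) (0 - 1)) = 1 := h₁ 0
  have e12 : ε₁ (paramGen (M 1) (2 - 1)) = 0 := h₁ 2
  have e20 : ε₂ (paramGen (M 2) (0 - 2)) = 1 := h₂ 0
  let f₀ : ParamOrbit (M 0) →+ ZMod (Nat.gcd m n) :=
    (ZMod.castHom (Nat.gcd_dvd_left m n) _).toAddMonoidHom.comp ε₀.toAddMonoidHom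
  let f₁ : ParamOrbit (M 1) →+ ZMod (Nat.gcd m n) :=
    (ZMod.castHom (Nat.gcd_dvd_right m n) _).toAddMonoidHom.comp ε₁.toAddMonoidHom
  have hf₀ : ∀ p, f₀ p = ZMod.castHom (Nat.gcd_dvd_left m n) _ (ε₀ p) := fun _ => rfl
  have hf₁ : ∀ p, f₁ p = ZMod.castHom (Nat.gcd_dvd_right m n) _ (ε₁ p) := fun _ => rfl
  let f : ((i : Fin 3) → ParamOrbit (M i)) →+ ZMod (Nat.gcd m n) :=
    f₀.comp (Pi.evalAddMonoidHom _ 0) - f₁.comp (Pi.evalAddMonoidHom _ 1)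
  have hf : ∀ g, f g = f₀ (g 0) - f₁ (g 1) := fun _ => rfl
  have hker : AddSubgroup.closure {g | ∃ i j : Fin 3, i < j ∧
      g = Pi.single i (paramGen (M i) (j - i)) + Pi.single j (paramGen (M j) (i - j))} =
        f.ker := by
    apply le_antisymm
    · rw [AddSubgroup.closure_le]
      rintro _ ⟨i, j, hij, rfl⟩
      change f _ = 0
      rw [hf]
      fin_cases i <;> fin_cases j <;> first | exact absurd hij (by decide) | skip
      · change f₀ (paramGen (M 0) (1 - 0) + 0) - f₁ (0 + paramGen (M 1) (0 - 1)) = 0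
        rw [add_zero, zero_add, hf₀, hf₁, e01, e10, map_one, map_one, sub_self]
      · change f₀ (paramGen (M 0) (2 - 0) + 0) - f₁ (0 + 0) = 0
        rw [add_zero, zero_add, hf₀, e02, map_zero, map_zero, sub_self]
      · change f₀ (0 + 0) - f₁ (paramGen (M 1) (2 - 1) + 0) = 0
        rw [add_zero, add_zero, hf₁, e12, map_zero, map_zero, sub_self]
    · intro g hg
      have hg' : f₀ (g 0) - f₁ (g 1) = 0 := hg
      rw [hf₀, hf₁, sub_eq_zero] at hg'
      obtain ⟨t, ht₀, ht₁⟩ := exists_int_cast_eq _ _ hg'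
      obtain ⟨s, hs⟩ := ZMod.intCast_surjective (ε₂ (g 2))
      -- The integer `t` lifts the first two components simultaneously. The relation between the
      -- first and third orbits, where `z` acts trivially on `x`, absorbs the third component.
      have hgen : g =
          t • (Pi.single 0 (paramGen (M 0) (1 - 0)) + Pi.single 1 (paramGen (M 1) (0 - 1))) +
          s • (Pi.single 0 (paramGen (M 0) (2 - 0)) + Pi.single 2 (paramGen (M 2) (0 - 2))) := by
        funext i
        fin_cases i
        · change g 0 = t • (paramGen (M 0) (1 - 0) + 0) + s • (paramGen (M 0) (2 - 0) + 0)
          apply ε₀.injective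
          rw [map_add, map_zsmul, map_zsmul, add_zero, add_zero, e01, e02, ← ht₀]
          simp
        · change g 1 = t • (0 + paramGen (M 1) (0 - 1)) + s • (0 + 0)
          apply ε₁.injective
          rw [map_add, map_zsmul, map_zsmul, add_zero, zero_add, e10, ← ht₁]
          simp
        · change g 2 = t • (0 + 0) + s • (0 + paramGen (M 2) (0 - 2))
          apply ε₂.injective
          rw [map_add, map_zsmul, map_zsmul, add_zero, zero_add, e20, ← hs]
          simp
      rw [hgen]
      refine add_mem (zsmul_mem ?_ _) (zsmul_mem ?_ _)
      · exact AddSubgroup.subset_closure ⟨0, 1, by decide, rfl⟩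
      · exact AddSubgroup.subset_closure ⟨0, 2, by decide, rfl⟩
  have hsurj : Function.Surjective f := by
    intro t
    obtain ⟨t, rfl⟩ := ZMod.intCast_surjective t
    refine ⟨Pi.single 0 (ε₀.symm t), ?_⟩
    change f₀ (ε₀.symm t) - f₁ 0 = t
    rw [map_zero, sub_zero, hf₀, AddEquiv.apply_symm_apply, map_intCast]
  exact ⟨(QuotientAddGroup.quotientAddEquivOfEq hker).trans
    (QuotientAddGroup.quotientKerEquivOfSurjective f hsurj)⟩

end UStar

end AbQuandle

theorem mainTheorem10 (m n : ℕ) (hm : 1 ≤ m) (hn : 1 ≤ n) :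
    (∃ M : Fin 3 → Matrix (Fin 2) (Fin 2) ℕ,
      AbQuandle.HasParameters (AbQuandle.UStar m n) AbQuandle.UStar.orbitIndex M) ∧
    (∀ M : Fin 3 → Matrix (Fin 2) (Fin 2) ℕ,
      AbQuandle.HasParameters (AbQuandle.UStar m n) AbQuandle.UStar.orbitIndex M →
        Nonempty (AbQuandle.ParameterGroup M ≃+ ZMod (Nat.gcd m n)) ∧
        (∀ i : ZMod m, Nonempty
          (AbQuandle.torsionGroup (AbQuandle.UStar.x i : AbQuandle.UStar m n) ≃+
            AbQuandle.ParameterGroup M)) ∧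
        (∀ k : ZMod n, Nonempty
          (AbQuandle.torsionGroup (AbQuandle.UStar.y k : AbQuandle.UStar m n) ≃+
            AbQuandle.ParameterGroup M)) ∧
        (∀ s : ZMod 2,
          (Nonempty (AbQuandle.torsionGroup (AbQuandle.UStar.z s : AbQuandle.UStar m n) ≃+
            AbQuandle.ParameterGroup M) ↔ Nat.gcd m n = 1 ∨ Nat.gcd m n = 2))) ∧
    Nonempty (AbQuandle.H₂ (AbQuandle.UStar m n) ≃+
      (Fin 9 → ℤ) × (Fin 2 → ZMod (Nat.gcd m n)) × ZMod (Nat.gcd (Nat.gcd m n) 2)) ∧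
    (∀ s : ZMod 2, Nonempty
      (AbQuandle.torsionGroup (AbQuandle.UStar.z s : AbQuandle.UStar m n) ≃+
        ZMod (Nat.gcd (Nat.gcd m n) 2))) := by
  have : NeZero m := ⟨by omega⟩
  have : NeZero n := ⟨by omega⟩
  refine ⟨AbQuandle.UStar.exists_hasParameters hm hn, fun M hM => ?_, ?_,
    AbQuandle.UStar.nonempty_torsionGroup_z⟩
  · obtain ⟨ε⟩ := AbQuandle.UStar.nonempty_parameterGroup_equiv hM
    refine ⟨⟨ε⟩, fun i => ?_, fun k => ?_, fun s => ?_⟩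
    · obtain ⟨η⟩ := AbQuandle.UStar.nonempty_torsionGroup_x (m := m) (n := n) i
      exact ⟨η.trans ε.symm⟩
    · obtain ⟨η⟩ := AbQuandle.UStar.nonempty_torsionGroup_y (m := m) (n := n) k
      exact ⟨η.trans ε.symm⟩
    · obtain ⟨η⟩ := AbQuandle.UStar.nonempty_torsionGroup_z (m := m) (n := n) s
      -- The gcd with `2` is the number itself exactly when that number divides the prime `2`.
      have hdvd : Nat.gcd (Nat.gcd m n) 2 = Nat.gcd m n ↔ Nat.gcd m n = 1 ∨ Nat.gcd m n = 2 := by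
        rw [Nat.gcd_eq_left_iff_dvd, Nat.dvd_prime Nat.prime_two]
      rw [← hdvd]
      constructor
      · rintro ⟨ζ⟩
        -- Cyclic groups `ZMod d` are told apart by their cardinality.
        simpa using Nat.card_congr ((η.symm.trans ζ).trans ε).toEquiv
      · intro h
        exact ⟨(η.trans (ZMod.ringEquivCongr h).toAddEquiv).trans ε.symm⟩
  · obtain ⟨ε⟩ := AbQuandle.UStar.nonempty_H₂_equiv_cycles (m := m) (n := n)
    exact ⟨ε.trans AbQuandle.UStar.cyclesEquiv⟩
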